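/- **Setting.** Let $\mathrm{Col}$ be a finite set of colours and $\delta$ a dimension. The $(\mathrm{Col},\delta)$-signature has a binary predicate $E^c$ for each $c\in\mathrm{Col}$ and unary predicates $U_1,\dots,U_\delta$; a $(\mathrm{Col},\delta)$-dataset is a finite set of ground atoms (facts) over this signature. Let $\mathcal N$ be a monotonic max-sum $(\mathrm{Col},\delta)$-GNN with $L\ge 1$ layers. That is, it has dimensions $\delta_0,\dots,\delta_L$ with $\delta_0=\delta_L=\delta$; for each layer $\ell\in\{1,\dots,L\}$, nonnegative matrices $A_\ell$ and $B_\ell^c$ ($c\in\mathrm{Col}$) of size $\delta_\ell\times\delta_{\ell-1}$, a real bias vector $b_\ell$, and a number $k_\ell\in\{0,1,2,\dots\}\cup\{\infty\}$; a monotone unbounded activation $\sigma:\mathbb R\to\mathbb R_{\ge0}$; and a threshold classifier $\mathrm{cls}(s)=1$ if $s\ge t$ and $\mathrm{cls}(s)=0$ if $s<t$. Applied to a graph with vertex labelling $\lambda_0$, it computes $$\lambda_\ell(v)=\sigma\Big(A_\ell\lambda_{\ell-1}(v)+\sum_{c}B^c_\ell\,\mathrm{maxsum}_{k_\ell}\{\!\{\lambda_{\ell-1}(u)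 : (v,u)\in E^c\}\!\}+b_\ell\Big),$$ where $\sigma$, $\mathrm{cls}$ and $\mathrm{maxsum}$ act coordinatewise and $\mathrm{maxsum}_k(S)$ is the sum of the $\min(k,|S|)$ largest elements of the multiset $S$. The canonical encoding of a dataset $D$ has the terms of $D$ as vertices, an edge $(t,s)$ of colour $c$ iff $E^c(t,s)\in D$, and $\lambda_0(t)_i=1$ if $U_i(t)\in D$ and $0$ otherwise. The canonical transformation $T_{\mathcal N}(D)$ consists of the facts $E^c(t,s)\in D$ and the facts $U_i(t)$, for $t$ a term of $D$, with $\mathrm{cls}(\lambda_L(t)_i)=1$. **Capacity.** Let $X_{0,i}=\{0,1\}$. For $\ell\ge1$ let $X_{\ell,i}$ be the set of all values $\sigma\big((A_\ell x+\sum_c B_\ell^c\,\mathrm{maxsum}_{k_\ell}(Y^c)+b_\ell)_i\big)$, where $x$ is a vector with $x_j\in X_{\ell-1,j}$ for all $j$, and each $Y^c$ is a finite multiset of such vectors. Put $\alpha_L=t$ and, for $\ell=L,L-1,\dots,1$, let $w_\ell$ be the least nonzero entry of $A_\ell$ and all $B_\ell^c$, and $x_\ell$ the least nonzero element of $\bigcup_iX_{\ell-1,i}$.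 If $w_\ell$ or $x_\ell$ does not exist, put $C_\ell=C_{\ell-1}=\dots=C_1=0$ and stop. Otherwise let $\beta_\ell$ be the least positive integer with $\sigma(\beta_\ell)\ge\alpha_\ell$, let $\underline b_\ell$ be the least entry of $b_\ell$, and put $$C_\ell=\min\Big(k_\ell,\ \max\Big(0,\Big\lceil\frac{\beta_\ell-\underline b_\ell}{w_\ell x_\ell}\Big\rceil\Big)\Big),\qquad \alpha_{\ell-1}=\frac{\beta_\ell-\underline b_\ell}{w_\ell}.$$ Put $C_{\mathcal N}=\max_{1\le\ell\le L}C_\ell$, $\delta_{\mathcal N}=\max_{0\le\ell\le L}\delta_\ell$ and $f=|\mathrm{Col}|\cdot\delta_{\mathcal N}\cdot C_{\mathcal N}$. **Rules.** Conjunctions are identified with their sets of conjuncts. Tree-like formulas for a variable $x$ are defined inductively: $\top$; $U_i(x)$; $\varphi_1\wedge\varphi_2$ for $\varphi_1,\varphi_2$ tree-like for $x$ sharing no variable other than $x$; and $\bigwedge_{i=1}^n(E^c(x,y_i)\wedge\varphi_i)\wedge\bigwedge_{1\le i<j\le n}y_i\ne y_j$ for distinct variables $y_1,\dots,y_n$ and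 $\varphi_i$ tree-like for $y_i$, where $x$ is neither $y_i$ nor in $\varphi_i$ for any $i$, and the sets consisting of $y_i$ and the variables of $\varphi_i$ are pairwise disjoint. The fan-out of a variable $y$ in $\varphi$ is the number of variables $z$ with some conjunct $E^c(y,z)$ in $\varphi$; the depth of $y$ is the maximal length of a chain of conjuncts $E^{c_1}(y_0,y_1),\dots,E^{c_n}(y_{n-1},y_n)$ of $\varphi$ with $y_n=y$. A rule is $(L,f)$-tree-like if it is of the form $\varphi\to U_i(x)$ with $\varphi$ tree-like for $x$ and every variable of $\varphi$ has depth $m\le L$ and fan-out at most $f\cdot(L-m)$. For a rule $r$ and a dataset $D$, $T_r(D)$ is the set of instances $H\nu$ of the head $H$ of $r$, for substitutions $\nu$ of all variables of $r$ by terms occurring in $D$ that make every body literal true in $D$; for a program $P$ (a finite set of rules), $T_P(D)=\bigcup_{r\in P}T_r(D)$. The GNN $\mathcal N$ captures $r$ if $T_r(D)\subseteq T_{\mathcal N}(D)$ for every $(\mathrm{Col},\delta)$-dataset $D$. **Theorem.** There is a program that consists of $(L,f)$-tree-like rules captured by $\mathcal N$ and contains every such rule up to variable renaming. Moreover, for every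 such program $P$ and every $(\mathrm{Col},\delta)$-dataset $D$, $$T_{\mathcal N}(D)=T_P(D)\cup\{E^c(t,s) : c\in\mathrm{Col},\ E^c(t,s)\in D\}.$$ That is, $T_{\mathcal N}(D)$ and $T_P(D)$ contain the same unary facts, and the binary facts of $T_{\mathcal N}(D)$ are exactly those of $D$. -/

import Mathlib

noncomputable section

namespace MaxSumGNN

/-! ### Datasets and Datalog over the `(Col, δ)`-signature -/

/-- A term: a variable or a constant. -/
inductive Term (Var K : Type*) where
  | var (x : Var)
  | const (a : K)

/-- The variables of a term. -/
def Term.vars {Var K : Type*} : Term Var K → Set Var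
  | .var x => {x}
  | .const _ => ∅

/-- The ground term obtained by applying a substitution. -/
def Term.subst {Var K : Type*} (ν : Var → K) : Term Var K → K
  | .var x => ν x
  | .const a => a

/-- Renaming of the variables of a term. -/
def Term.rename {Var K : Type*} (ρ : Var → Var) : Term Var K → Term Var K
  | .var x => .var (ρ x)
  | .const a => .const a

/-- Atoms over the `(Col, δ)`-signature, with arguments from `T`: the unary predicates are `U_i`
for `i : Fin δ`, and the binary predicates are `E^c` for `c : Col`. -/
inductive Atom (Col : Type*) (δ : ℕ) (T : Type*) where
  | unary (i : Fin δ) (t : T)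
  | edge (c : Col) (t s : T)

namespace Atom

variable {Col : Type*} {δ : ℕ} {T T' : Type*}

/-- Replace every argument of an atom. -/
def map (g : T → T') : Atom Col δ T → Atom Col δ T'
  | unary i t => unary i (g t)
  | edge c t s => edge c (g t) (g s)

/-- The arguments of an atom. -/
def args : Atom Col δ T → Set T
  | unary _ t => {t}
  | edge _ t s => {t, s}

end Atom

/-- Literals: atoms and inequalities. -/
inductive Literal (Col : Type*) (δ : ℕ) (T : Type*) where
  | atom (a : Atom Col δ T)
  | ne (t s : T)

namespace Literal

variable {Col : Type*} {δ : ℕ} {T T' : Type*}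

/-- Replace every argument of a literal. -/
def map (g : T → T') : Literal Col δ T → Literal Col δ T'
  | atom a => atom (a.map g)
  | ne t s => ne (g t) (g s)

/-- The arguments of a literal. -/
def args : Literal Col δ T → Set T
  | atom a => a.args
  | ne t s => {t, s}

end Literal

/-- A `(Col, δ)`-fact is a ground atom over the constants `K`. -/
abbrev Fact (Col : Type*) (δ : ℕ) (K : Type*) := Atom Col δ K

/-- A `(Col, δ)`-dataset is a finite set of `(Col, δ)`-facts. -/
abbrev Dataset (Col : Type*) (δ : ℕ) (K : Type*) := Finset (Fact Col δ K)

/-- The (ground) terms occurring in a dataset. -/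
def Dataset.terms {Col : Type*} {δ : ℕ} {K : Type*} (D : Dataset Col δ K) : Set K :=
  {t | ∃ a ∈ D, t ∈ a.args}

theorem Dataset.finite_terms {Col : Type*} {δ : ℕ} {K : Type*} (D : Dataset Col δ K) :
    (Dataset.terms D).Finite := by
  have h : Dataset.terms D = ⋃ a ∈ (D : Set (Fact Col δ K)), a.args := by
    ext t
    simp [Dataset.terms]
  rw [h]
  refine D.finite_toSet.biUnion fun a _ => ?_
  cases a <;> simp [Atom.args]

/-- Truth of a ground literal in a dataset. -/
def Literal.Holds {Col : Type*} {δ : ℕ} {K : Type*} (D : Dataset Col δ K) :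
    Literal Col δ K → Prop
  | .atom a => a ∈ D
  | .ne s t => s ≠ t

/-- The set of variables of a conjunction of literals, given as the set of its conjuncts. -/
def conjVars {Col : Type*} {δ : ℕ} {Var K : Type*} (φ : Set (Literal Col δ (Term Var K))) :
    Set Var :=
  {x | ∃ l ∈ φ, ∃ t ∈ l.args, x ∈ t.vars}

/-- A Datalog rule. The body is the finite set of its conjuncts; no safety is required. -/
structure Rule (Col : Type*) (δ : ℕ) (Var K : Type*) where
  body : Finset (Literal Col δ (Term Var K))
  head : Atom Col δ (Term Var K)

/-- The variables of a rule, those of the head included. -/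
def Rule.vars {Col : Type*} {δ : ℕ} {Var K : Type*} (r : Rule Col δ Var K) : Set Var :=
  conjVars (r.body : Set (Literal Col δ (Term Var K))) ∪ conjVars {Literal.atom r.head}

/-- The immediate consequence operator of a rule: all facts `Hν` where `ν` maps all variables of
the rule to terms occurring in `D` and every body literal is true in `D` under `ν`. -/
def Rule.consequences {Col : Type*} {δ : ℕ} {Var K : Type*} (r : Rule Col δ Var K)
    (D : Dataset Col δ K) : Set (Fact Col δ K) :=
  {F | ∃ ν : Var → K, (∀ x ∈ r.vars, ν x ∈ Dataset.terms D) ∧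
    (∀ l ∈ r.body, (l.map (Term.subst ν)).Holds D) ∧ F = r.head.map (Term.subst ν)}

/-- A Datalog program is a finite set of rules. -/
abbrev Program (Col : Type*) (δ : ℕ) (Var K : Type*) := Finset (Rule Col δ Var K)

/-- The immediate consequence operator of a program. -/
def Program.consequences {Col : Type*} {δ : ℕ} {Var K : Type*} (P : Program Col δ Var K)
    (D : Dataset Col δ K) : Set (Fact Col δ K) :=
  ⋃ r ∈ P, r.consequences D

/-- Equality of rules up to variable renaming. -/
def Rule.EqUpToRenaming {Col : Type*} {δ : ℕ} {Var K : Type*} (r r' : Rule Col δ Var K) : Prop :=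
  ∃ ρ : Var → Var, Set.BijOn ρ r.vars r'.vars ∧
    (fun l : Literal Col δ (Term Var K) => l.map (Term.rename ρ)) ''
      (r.body : Set (Literal Col δ (Term Var K))) = (r'.body : Set (Literal Col δ (Term Var K))) ∧
    r.head.map (Term.rename ρ) = r'.head

/-! ### Coloured graphs and graph neural networks -/

/-- A `(Col, δ)`-graph whose vertices form a finite subset of `V`. Only the labels of vertices in
`verts` are meaningful. -/
structure ColGraph (Col : Type*) (δ : ℕ) (V : Type*) where
  verts : Finset V
  edge : Col → V → V → Prop
  edge_mem : ∀ c v u, edge c v u → v ∈ verts ∧ u ∈ verts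
  label : V → Fin δ → ℝ

open Classical in
/-- The set of `u` such that there is an edge of colour `c` from `v` to `u`. -/
def ColGraph.nbrs {Col : Type*} {δ : ℕ} {V : Type*} (G : ColGraph Col δ V) (c : Col) (v : V) :
    Finset V :=
  G.verts.filter fun u => G.edge c v u

/-- A `(Col, δ)`-GNN with `L ≥ 1` layers. The parameters of layer `ℓ + 1`, for `ℓ < L`, are stored
at index `ℓ`; entries with `ℓ ≥ L` (and `dim ℓ` for `ℓ > L`) play no role. -/
structure GNN (Col : Type*) (δ : ℕ) where
  L : ℕ
  one_le_L : 1 ≤ L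
  dim : ℕ → ℕ
  dim_zero : dim 0 = δ
  dim_last : dim L = δ
  A : (ℓ : ℕ) → Matrix (Fin (dim (ℓ + 1))) (Fin (dim ℓ)) ℝ
  B : (ℓ : ℕ) → Col → Matrix (Fin (dim (ℓ + 1))) (Fin (dim ℓ)) ℝ
  bias : (ℓ : ℕ) → Fin (dim (ℓ + 1)) → ℝ
  agg : ℕ → Multiset ℝ → ℝ
  act : ℝ → ℝ
  cls : ℝ → ℝ
  cls_boolean : ∀ x, cls x = 0 ∨ cls x = 1

namespace GNN

variable {Col : Type*} [Fintype Col] {δ : ℕ}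

/-- The argument of the activation function in layer `ℓ + 1`, for `x` the vector of a vertex in
layer `ℓ` and `Y c` the multiset of the vectors of its neighbours of colour `c`. Aggregation is
applied to each coordinate. -/
def val (N : GNN Col δ) (ℓ : ℕ) (x : Fin (N.dim ℓ) → ℝ)
    (Y : Col → Multiset (Fin (N.dim ℓ) → ℝ)) : Fin (N.dim (ℓ + 1)) → ℝ :=
  (N.A ℓ).mulVec x
    + (∑ c, (N.B ℓ c).mulVec fun j => N.agg ℓ ((Y c).map fun y => y j))
    + N.bias ℓ

/-- The vertex labelling in layer `ℓ` when the GNN is applied to `G`. -/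
def layer {V : Type*} (N : GNN Col δ) (G : ColGraph Col δ V) :
    (ℓ : ℕ) → V → Fin (N.dim ℓ) → ℝ
  | 0 => fun v i => G.label v (Fin.cast N.dim_zero i)
  | ℓ + 1 => fun v i =>
      N.act (N.val ℓ (layer N G ℓ v)
        (fun c => (G.nbrs c v).val.map fun u => layer N G ℓ u) i)

/-- The result of applying the GNN to a graph: same vertices and edges, labels classified. -/
def apply {V : Type*} (N : GNN Col δ) (G : ColGraph Col δ V) : ColGraph Col δ V where
  verts := G.verts
  edge := G.edge
  edge_mem := G.edge_mem
  label := fun v i => N.cls (N.layer G N.L v (Fin.cast N.dim_last.symm i))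

end GNN

/-! ### Canonical encoding and decoding -/

open Classical in
/-- The canonical encoding; the vertex paired with a term `t` is `t` itself. -/
def canEnc {Col : Type*} {δ : ℕ} {K : Type*} (D : Dataset Col δ K) : ColGraph Col δ K where
  verts := (Dataset.finite_terms D).toFinset
  edge := fun c t s => Atom.edge c t s ∈ D
  edge_mem := by
    intro c t s h
    simp only [Set.Finite.mem_toFinset]
    exact ⟨⟨_, h, by simp [Atom.args]⟩, ⟨_, h, by simp [Atom.args]⟩⟩
  label := fun t i => if Atom.unary i t ∈ D then 1 else 0

/-- The canonical decoding. -/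
def canDec {Col : Type*} {δ : ℕ} {K : Type*} (G : ColGraph Col δ K) : Set (Fact Col δ K) :=
  {F | (∃ c t s, G.edge c t s ∧ F = Atom.edge c t s) ∨
    (∃ t ∈ G.verts, ∃ i, G.label t i = 1 ∧ F = Atom.unary i t)}

namespace GNN

variable {Col : Type*} [Fintype Col] {δ : ℕ}

/-- The canonical transformation of datasets induced by a GNN. -/
def transform {K : Type*} (N : GNN Col δ) (D : Dataset Col δ K) : Set (Fact Col δ K) :=
  canDec (N.apply (canEnc D))

/-- The GNN captures the rule `r`. -/
def Captures {Var K : Type*} (N : GNN Col δ) (r : Rule Col δ Var K) : Prop :=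
  ∀ D : Dataset Col δ K, r.consequences D ⊆ N.transform D

end GNN

/-! ### Monotonic max-sum GNNs -/

/-- The sum of the `min k |S|` largest elements of `S`, counted with multiplicity. -/
def maxSum (k : ℕ∞) (S : Multiset ℝ) : ℝ :=
  ((S.sort (· ≥ ·)).take (min k (S.card : ℕ∞)).toNat).sum

/-- A GNN is monotonic max-sum; `k` (where `k ℓ` belongs to layer `ℓ + 1`) and `threshold` are the
numbers in its aggregation functions and its classification function. -/
structure MonotonicMaxSum {Col : Type*} {δ : ℕ} (N : GNN Col δ) where
  k : ℕ → ℕ∞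
  threshold : ℝ
  A_nonneg : ∀ ℓ < N.L, ∀ i j, 0 ≤ N.A ℓ i j
  B_nonneg : ∀ ℓ < N.L, ∀ c i j, 0 ≤ N.B ℓ c i j
  agg_eq : ∀ ℓ < N.L, N.agg ℓ = maxSum (k ℓ)
  act_mono : ∀ x y, x < y → N.act x ≤ N.act y
  act_unbounded : ∀ y, ∃ x, y < N.act x
  act_nonneg : ∀ x, 0 ≤ N.act x
  cls_eq_zero : ∀ t, t < threshold → N.cls t = 0
  cls_eq_one : ∀ t, threshold ≤ t → N.cls t = 1

namespace GNN

variable {Col : Type*} [Fintype Col] {δ : ℕ}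

/-- The sets of possible values in position `i` of a vector in layer `ℓ`. -/
def possible (N : GNN Col δ) : (ℓ : ℕ) → Fin (N.dim ℓ) → Set ℝ
  | 0 => fun _ => {0, 1}
  | ℓ + 1 => fun i =>
      {z | ∃ (x : Fin (N.dim ℓ) → ℝ) (Y : Col → Multiset (Fin (N.dim ℓ) → ℝ)),
        (∀ j, x j ∈ possible N ℓ j) ∧ (∀ c, ∀ y ∈ Y c, ∀ j, y j ∈ possible N ℓ j) ∧
        z = N.act (N.val ℓ x Y i)}

/-- The nonzero entries of the matrices of layer `ℓ + 1`. -/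
def nonzeroWeights (N : GNN Col δ) (ℓ : ℕ) : Set ℝ :=
  {w | w ≠ 0 ∧ ∃ i j, w = N.A ℓ i j ∨ ∃ c, w = N.B ℓ c i j}

/-- The nonzero possible values in layer `ℓ`. -/
def nonzeroValues (N : GNN Col δ) (ℓ : ℕ) : Set ℝ :=
  {z | z ≠ 0 ∧ ∃ i, z ∈ N.possible ℓ i}

/-- The maximum of the dimensions of layers `0, …, L`. -/
def maxDim (N : GNN Col δ) : ℕ := (Finset.range (N.L + 1)).sup N.dim

end GNN

namespace MonotonicMaxSum

variable {Col : Type*} [Fintype Col] {δ : ℕ} {N : GNN Col δ}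

/-- The least positive integer `n` with `α ≤ σ(n)`. -/
def leastArg (_h : MonotonicMaxSum N) (α : ℝ) : ℕ := sInf {n : ℕ | 1 ≤ n ∧ α ≤ N.act n}

open Classical in
/-- The downward pass computing the capacities of layers `ℓ, …, 1` from the target value `α` for
layer `ℓ`; the last argument is the layer whose capacity is returned. In layer `ℓ + 1`, if there is
no least nonzero weight `w` or no least nonzero possible value `x` of layer `ℓ`, then the
capacities of layers `ℓ + 1, …, 1` are all `0`. Otherwise, with `β` the least positive integer such
that `α ≤ σ(β)` and `b` the least element of the bias, the capacity of layer `ℓ + 1` is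
`min k ⌈(β - b) / (w * x)⌉`, where a negative ceiling counts as `0`, and the pass continues in
layer `ℓ` with target value `(β - b) / w`. -/
def capacityPass (h : MonotonicMaxSum N) : ℕ → ℝ → ℕ → ℕ
  | 0, _, _ => 0
  | ℓ + 1, α, m =>
      if (∃ w, IsLeast (N.nonzeroWeights ℓ) w) ∧ (∃ x, IsLeast (N.nonzeroValues ℓ) x) then
        let w : ℝ := sInf (N.nonzeroWeights ℓ)
        let x : ℝ := sInf (N.nonzeroValues ℓ)
        let β : ℕ := h.leastArg α
        let b : ℝ := ⨅ i, N.bias ℓ i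
        if m = ℓ + 1 then (min (h.k ℓ) ((⌈((β : ℝ) - b) / (w * x)⌉₊ : ℕ) : ℕ∞)).toNat
        else capacityPass h ℓ (((β : ℝ) - b) / w) m
      else 0

/-- The capacity of layer `m`, for `1 ≤ m ≤ L`. -/
def layerCapacity (h : MonotonicMaxSum N) (m : ℕ) : ℕ := h.capacityPass N.L h.threshold m

/-- The capacity of a monotonic max-sum GNN. -/
def capacity (h : MonotonicMaxSum N) : ℕ := (Finset.Icc 1 N.L).sup h.layerCapacity

end MonotonicMaxSum

/-! ### Tree-like formulas and rules -/

section TreeLike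

variable {Col : Type*} {δ : ℕ} {Var K : Type*}

/-- The literal `U_i(x)`. -/
def unaryLit (i : Fin δ) (x : Var) : Literal Col δ (Term Var K) := .atom (.unary i (.var x))

/-- The literal `E^c(x, y)`. -/
def edgeLit (c : Col) (x y : Var) : Literal Col δ (Term Var K) := .atom (.edge c (.var x) (.var y))

/-- The literal `x ≠ y`. -/
def neLit (x y : Var) : Literal Col δ (Term Var K) := .ne (.var x) (.var y)

/-- `TreeLike x φ`: the conjunction with set of conjuncts `φ` is a tree-like formula for `x`. In
the last case each `y i` counts as a variable of `φ i`, even where `φ i` is `⊤`. -/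
inductive TreeLike : Var → Set (Literal Col δ (Term Var K)) → Prop
  | top (x : Var) : TreeLike x ∅
  | unary (x : Var) (i : Fin δ) : TreeLike x {unaryLit i x}
  | and (x : Var) (φ₁ φ₂ : Set (Literal Col δ (Term Var K))) :
      TreeLike x φ₁ → TreeLike x φ₂ → conjVars φ₁ ∩ conjVars φ₂ ⊆ {x} →
      TreeLike x (φ₁ ∪ φ₂)
  | count (x : Var) (c : Col) (n : ℕ) (y : Fin n → Var)
      (φ : Fin n → Set (Literal Col δ (Term Var K))) :
      Function.Injective y →
      (∀ i, TreeLike (y i) (φ i)) →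
      (∀ i, x ∉ insert (y i) (conjVars (φ i))) →
      (∀ i j, i ≠ j → Disjoint (insert (y i) (conjVars (φ i))) (insert (y j) (conjVars (φ j)))) →
      TreeLike x ((⋃ i, insert (edgeLit c x (y i)) (φ i)) ∪
        {l | ∃ i j, i < j ∧ l = neLit (y i) (y j)})

/-- The fan-out of `x` in `φ`: the number of variables `y` with some conjunct `E^c(x, y)`. -/
def fanOut (φ : Set (Literal Col δ (Term Var K))) (x : Var) : ℕ :=
  {y : Var | ∃ c : Col, edgeLit c x y ∈ φ}.ncard

/-- `x` has depth `n` in `φ`: `n` is the maximal length of a chain of conjuncts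
`E^{c_1}(x_0, x_1), …, E^{c_n}(x_{n-1}, x_n)` with `x_n = x`. -/
def HasDepth (φ : Set (Literal Col δ (Term Var K))) (x : Var) (n : ℕ) : Prop :=
  IsGreatest {m : ℕ | ∃ p : ℕ → Var, p m = x ∧
    ∀ i < m, ∃ c : Col, edgeLit c (p i) (p (i + 1)) ∈ φ} n

/-- `(d, f)`-tree-like rules: the rules `φ → U(x)` where `φ` is tree-like for `x`, and every
variable in `φ` has some depth `i ≤ d` and fan-out at most `f (d - i)`. -/
def Rule.IsTreeLike (d f : ℕ) (r : Rule Col δ Var K) : Prop :=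
  ∃ (x : Var) (i : Fin δ), r.head = .unary i (.var x) ∧
    TreeLike x (r.body : Set (Literal Col δ (Term Var K))) ∧
    ∀ y ∈ conjVars (r.body : Set (Literal Col δ (Term Var K))),
      ∃ n, HasDepth (r.body : Set (Literal Col δ (Term Var K))) y n ∧ n ≤ d ∧
        fanOut (r.body : Set (Literal Col δ (Term Var K))) y ≤ f * (d - n)

end TreeLike

/-- `P` is the program that contains, up to variable renaming, each
`(L, |Col| · δ_N · C_N)`-tree-like rule captured by `N` (and no other rules). -/
def MonotonicMaxSum.IsRuleProgram {Col : Type*} [Fintype Col] {δ : ℕ} {Var K : Type*}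
    {N : GNN Col δ} (h : MonotonicMaxSum N) (P : Program Col δ Var K) : Prop :=
  (∀ r ∈ P, r.IsTreeLike N.L (Fintype.card Col * N.maxDim * h.capacity) ∧ N.Captures r) ∧
  (∀ r : Rule Col δ Var K,
    r.IsTreeLike N.L (Fintype.card Col * N.maxDim * h.capacity) → N.Captures r →
      ∃ r' ∈ P, r.EqUpToRenaming r')

end MaxSumGNN

end

/-!
A monotonic max-sum GNN `N` is equivalent to the program of the tree-like rules that it captures.

The rules of the program are sound because they are captured. For completeness, each fact `U_i(t)`
in the transform of a dataset `D` has to be derived by a captured tree-like rule.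

The capacity `C` is large enough for every aggregation `maxSum (k ℓ)` to be replaced by
`maxSum (min C (k ℓ))` without changing the classification (`threshold_le_layerWith`). This is an
induction over the layers in step with `capacityPass`: with target value `α`, the truncated value
is exact or already at least `α` (`layerWith_eq_or_le`). If the argument of the activation function
stays below the number `β` with `α ≤ σ(β)`, then each entry with a nonzero weight is below the
target value `(β - b) / w` of the previous layer, hence exact, and, unless `k ℓ ≤ C`, fewer than `C`
of the summands, which are `0` or at least the least nonzero value `x`, can be nonzero. The least
nonzero value exists because the sets of possible values are well-ordered (`isPWO_possible`), as
additive monoids generated by well-ordered sets of nonnegative numbers are.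

The truncated value of `t` depends on at most `maxDim * C` neighbours of each colour in each layer.
Unravelling `D` at `t` along these neighbours gives a tree-like formula (`treeForm`) with the
required depth and fan-out. The formula is true at `t` in `D`, and by monotonicity, wherever it is
true in a dataset, the value there is at least the truncated value of `t`
(`layerWith_le_of_holds`); the inequalities in the formula keep distinct neighbours distinct. So
the rule with this body is captured.

The program exists because the bounds on depth and fan-out bound the number of variables of a rule,
so that a permutation of the variables moves each rule into a fixed finite set of variables.
-/

noncomputable section

namespace MaxSumGNN

/-! ### Sums of the largest elements of a multiset -/

/-- In a decreasing list of nonnegative numbers, no `n` entries have a larger sum than the first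
`n`. -/
theorem sum_le_sum_take_of_sublist :
    ∀ (l : List ℝ), l.Pairwise (· ≥ ·) → (∀ a ∈ l, 0 ≤ a) → ∀ (n : ℕ) (t : List ℝ),
      t.Sublist l → t.length ≤ n → t.sum ≤ (l.take n).sum := by
  intro l
  induction l with
  | nil =>
    intro _ _ n t ht _
    simp [List.sublist_nil.mp ht]
  | cons a l ih =>
    intro hs h0 n t ht hn
    rcases t with _ | ⟨b, t⟩
    · exact (List.sum_nonneg fun x hx => h0 x (List.mem_of_mem_take hx)).trans' (by simp)
    · obtain ⟨m, rfl⟩ : ∃ m, n = m + 1 := ⟨n - 1, by simp at hn; omega⟩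
      have hb : b ≤ a := by
        rcases List.mem_cons.mp (ht.subset List.mem_cons_self) with h | h
        · exact h.le
        · exact (List.pairwise_cons.mp hs).1 b h
      have htl : t.Sublist l := by
        rcases ht with _ | h | h
        · exact (List.sublist_cons_self b t).trans (by assumption)
        · assumption
      have := ih (List.pairwise_cons.mp hs).2 (fun x hx => h0 x (List.mem_cons_of_mem _ hx)) m t
        htl (by simpa using hn)
      simp only [List.sum_cons, List.take_succ_cons]
      linarith

theorem exists_le_maxSum_eq (k : ℕ∞) (S : Multiset ℝ) :
    ∃ T ≤ S, (T.card : ℕ∞) ≤ k ∧ maxSum k S = T.sum := by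
  refine ⟨↑((S.sort (· ≥ ·)).take (min k (S.card : ℕ∞)).toNat), ?_, ?_, by simp [maxSum]⟩
  · conv_rhs => rw [← Multiset.sort_eq S (· ≥ ·)]
    exact (List.take_sublist _ _).subperm
  · have : (((min k (S.card : ℕ∞)).toNat : ℕ) : ℕ∞) ≤ k := (ENat.natCast_toNat_le_self _).trans
      (min_le_left _ _)
    refine le_trans ?_ this
    simp only [Multiset.coe_card, List.length_take]
    exact_mod_cast min_le_left _ _

theorem sum_le_maxSum {k : ℕ∞} {S T : Multiset ℝ} (h0 : ∀ a ∈ S, 0 ≤ a) (hT : T ≤ S)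
    (hk : (T.card : ℕ∞) ≤ k) : T.sum ≤ maxSum k S := by
  have hle : T.card ≤ (min k (S.card : ℕ∞)).toNat := by
    have h1 : (T.card : ℕ∞) ≤ min k (S.card : ℕ∞) :=
      le_min hk (by exact_mod_cast Multiset.card_le_card hT)
    have h2 : min k (S.card : ℕ∞) ≠ ⊤ := ne_top_of_le_ne_top (ENat.natCast_ne_top _) (min_le_right _ _)
    rw [← ENat.natCast_toNat h2] at h1
    exact_mod_cast h1
  rw [← Multiset.sort_eq S (· ≥ ·)] at hT
  induction T using Quotient.inductionOn with
  | h t =>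
    obtain ⟨t', hp, hs⟩ : List.Subperm t (S.sort (· ≥ ·)) := hT
    have := sum_le_sum_take_of_sublist (S.sort (· ≥ ·)) (Multiset.pairwise_sort S (· ≥ ·))
      (fun a ha => h0 a (by simpa using ha)) (min k (S.card : ℕ∞)).toNat t' hs
      (by rw [hp.length_eq]; simpa using hle)
    rw [hp.sum_eq] at this
    simpa [maxSum] using this

theorem le_maxSum_of_mem {k : ℕ∞} (hk : 1 ≤ k) {S : Multiset ℝ} (h0 : ∀ a ∈ S, 0 ≤ a) {a : ℝ}
    (ha : a ∈ S) : a ≤ maxSum k S := by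
  simpa using sum_le_maxSum (T := {a}) h0 (by simpa using ha) (by simpa using hk)

theorem maxSum_nonneg (k : ℕ∞) {S : Multiset ℝ} (h0 : ∀ a ∈ S, 0 ≤ a) : 0 ≤ maxSum k S := by
  simpa using sum_le_maxSum (T := 0) (k := k) h0 (by simp) (by simp)

theorem maxSum_mono {k k' : ℕ∞} (hk : k ≤ k') {S : Multiset ℝ} (h0 : ∀ a ∈ S, 0 ≤ a) :
    maxSum k S ≤ maxSum k' S := by
  obtain ⟨T, hT, hc, he⟩ := exists_le_maxSum_eq k S
  rw [he]
  exact sum_le_maxSum h0 hT (hc.trans hk)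

theorem maxSum_le_sum (k : ℕ∞) {S : Multiset ℝ} (h0 : ∀ a ∈ S, 0 ≤ a) :
    maxSum k S ≤ S.sum := by
  obtain ⟨T, hT, -, he⟩ := exists_le_maxSum_eq k S
  obtain ⟨U, rfl⟩ := Multiset.le_iff_exists_add.mp hT
  rw [he, Multiset.sum_add]
  have : 0 ≤ U.sum := Multiset.sum_nonneg fun a ha => h0 a (by simp [ha])
  linarith

/-- If the sum of the `C` largest elements is less than `C` times a lower bound `x` of the nonzero
elements, then fewer than `C` elements are nonzero, so that a larger bound on the number of
summands does not change the sum. -/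
theorem maxSum_eq_of_lt {C : ℕ} {k : ℕ∞} (hk : (C : ℕ∞) ≤ k) {S : Multiset ℝ}
    (h0 : ∀ a ∈ S, 0 ≤ a) {x : ℝ} (hx : ∀ a ∈ S, a ≠ 0 → x ≤ a) (hlt : maxSum C S < C * x) :
    maxSum C S = maxSum k S := by
  refine le_antisymm (maxSum_mono hk h0) ((maxSum_le_sum k h0).trans ?_)
  classical
  set p := S.filter (· ≠ 0) with hp
  have hpS : p.sum = S.sum := by
    rw [← Multiset.sum_filter_add_sum_filter_not (s := S) (p := (· ≠ 0))]
    have : (S.filter fun a => ¬ a ≠ 0).sum = 0 :=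
      Multiset.sum_eq_zero fun a ha => by simpa using (Multiset.mem_filter.mp ha).2
    rw [this, add_zero]
  by_cases hc : p.card ≤ C
  · rw [← hpS]
    exact sum_le_maxSum h0 (Multiset.filter_le _ _) (by exact_mod_cast hc)
  · exfalso
    obtain ⟨T, hT⟩ : ∃ T, T ∈ Multiset.powersetCard C p := by
      apply Multiset.exists_mem_of_ne_zero
      intro h
      have := congrArg Multiset.card h
      rw [Multiset.card_powersetCard] at this
      simp only [Multiset.card_zero, Nat.choose_eq_zero_iff] at this
      omega
    obtain ⟨hTp, hTc⟩ := Multiset.mem_powersetCard.mp hT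
    have h1 := sum_le_maxSum (k := (C : ℕ∞)) h0 (hTp.trans (Multiset.filter_le _ _)) (by rw [hTc])
    have h2 : T.card • x ≤ T.sum := Multiset.card_nsmul_le_sum fun a ha => by
      have := Multiset.mem_filter.mp (Multiset.mem_of_le hTp ha)
      exact hx a this.1 this.2
    rw [hTc, nsmul_eq_mul] at h2
    linarith

/-- `exists_le_maxSum_eq` for a family indexed by a finite set: the summands are picked out by a
set of indices. -/
theorem exists_subset_maxSum_eq {V : Type*} (k : ℕ∞) (s : Finset V) (g : V → ℝ) :
    ∃ I ⊆ s, (I.card : ℕ∞) ≤ k ∧ maxSum k (s.val.map g) = ∑ u ∈ I, g u := by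
  classical
  obtain ⟨T, hT, hc, he⟩ := exists_le_maxSum_eq k (s.val.map g)
  induction T using Quotient.inductionOn with
  | h t =>
    have hs : s.val.map g = ↑(s.toList.map g) := by simp [← Multiset.map_coe]
    rw [hs] at hT
    obtain ⟨t', hp, hsub⟩ : List.Subperm t (s.toList.map g) := hT
    obtain ⟨l, hl, rfl⟩ := List.sublist_map_iff.mp hsub
    have hnd : l.Nodup := hl.nodup s.nodup_toList
    refine ⟨l.toFinset, fun u hu => by simpa using hl.subset (List.mem_toFinset.mp hu), ?_, ?_⟩
    · rw [List.toFinset_card_of_nodup hnd]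
      have := hp.length_eq
      simp only [List.length_map] at this
      rw [this]
      simpa using hc
    · rw [he, List.sum_toFinset _ hnd, hp.sum_eq]
      simp

theorem sum_le_maxSum_of_injOn {I V : Type*} {k : ℕ∞} {s : Finset V} {g : V → ℝ}
    (h0 : ∀ u ∈ s, 0 ≤ g u) {T : Finset I} {f : I → ℝ} {e : I → V} (he : Set.InjOn e T)
    (hes : ∀ i ∈ T, e i ∈ s) (hfg : ∀ i ∈ T, f i ≤ g (e i)) (hk : (T.card : ℕ∞) ≤ k) :
    ∑ i ∈ T, f i ≤ maxSum k (s.val.map g) := by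
  classical
  refine (Finset.sum_le_sum hfg).trans ?_
  rw [← Finset.sum_image (f := g) he]
  refine sum_le_maxSum (by simpa using h0) (Multiset.map_le_map (Finset.val_le_iff.mpr ?_)) ?_
  · intro u hu
    obtain ⟨i, hi, rfl⟩ := Finset.mem_image.mp hu
    exact hes i hi
  · rwa [Multiset.card_map, Finset.card_val, Finset.card_image_of_injOn he]

/-! ### Layers with a prescribed number of summands -/

namespace GNN

variable {Col : Type*} [Fintype Col] {δ : ℕ}

/-- The argument of the activation function in layer `ℓ + 1`, for `x` the vector of a vertex in
layer `ℓ` and `m c` the aggregated vector of its neighbours of colour `c`. -/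
def preact (N : GNN Col δ) (ℓ : ℕ) (x : Fin (N.dim ℓ) → ℝ) (m : Col → Fin (N.dim ℓ) → ℝ)
    (i : Fin (N.dim (ℓ + 1))) : ℝ :=
  ∑ j, N.A ℓ i j * x j + ∑ c, ∑ j, N.B ℓ c i j * m c j + N.bias ℓ i

theorem val_eq_preact (N : GNN Col δ) (ℓ : ℕ) (x : Fin (N.dim ℓ) → ℝ)
    (Y : Col → Multiset (Fin (N.dim ℓ) → ℝ)) (i : Fin (N.dim (ℓ + 1))) :
    N.val ℓ x Y i = N.preact ℓ x (fun c j => N.agg ℓ ((Y c).map fun y => y j)) i := by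
  simp [val, preact, Matrix.mulVec, dotProduct]

/-- The vertex labelling in layer `ℓ` when the aggregation in layer `ℓ + 1` is replaced by the sum
of the `κ ℓ` largest elements. -/
def layerWith {V : Type*} (N : GNN Col δ) (κ : ℕ → ℕ∞) (G : ColGraph Col δ V) :
    (ℓ : ℕ) → V → Fin (N.dim ℓ) → ℝ
  | 0 => fun v i => G.label v (Fin.cast N.dim_zero i)
  | ℓ + 1 => fun v i =>
      N.act (N.preact ℓ (layerWith N κ G ℓ v)
        (fun c j => maxSum (κ ℓ) ((G.nbrs c v).val.map fun u => layerWith N κ G ℓ u j)) i)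

end GNN

namespace MonotonicMaxSum

variable {Col : Type*} {δ : ℕ} {N : GNN Col δ}

theorem monotone_act (h : MonotonicMaxSum N) : Monotone N.act := by
  intro x y hxy
  rcases hxy.lt_or_eq with h1 | h1
  · exact h.act_mono x y h1
  · rw [h1]

variable [Fintype Col]

theorem preact_mono (h : MonotonicMaxSum N) {ℓ : ℕ} (hℓ : ℓ < N.L) {x x' : Fin (N.dim ℓ) → ℝ}
    {m m' : Col → Fin (N.dim ℓ) → ℝ} (hx : ∀ j, x j ≤ x' j) (hm : ∀ c j, m c j ≤ m' c j)
    (i : Fin (N.dim (ℓ + 1))) : N.preact ℓ x m i ≤ N.preact ℓ x' m' i := by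
  have hA := h.A_nonneg ℓ hℓ
  have hB := h.B_nonneg ℓ hℓ
  unfold GNN.preact
  gcongr with j _ c _ j _
  · exact hA i j
  · exact hx j
  · exact hB c i j
  · exact hm c j

theorem layer_eq_layerWith {V : Type*} (h : MonotonicMaxSum N) (G : ColGraph Col δ V) :
    ∀ ℓ ≤ N.L, N.layer G ℓ = N.layerWith h.k G ℓ := by
  intro ℓ
  induction ℓ with
  | zero => intro _; rfl
  | succ ℓ ih =>
    intro hℓ
    funext v i
    simp only [GNN.layer, GNN.layerWith, GNN.val_eq_preact, h.agg_eq ℓ hℓ, ih (by omega),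
      Multiset.map_map, Function.comp_def]

theorem layerWith_nonneg {V : Type*} (h : MonotonicMaxSum N) (κ : ℕ → ℕ∞) {G : ColGraph Col δ V}
    (hG : ∀ v i, G.label v i = 0 ∨ G.label v i = 1) (ℓ : ℕ) (v : V) (i : Fin (N.dim ℓ)) :
    0 ≤ N.layerWith κ G ℓ v i := by
  cases ℓ with
  | zero => rcases hG v (Fin.cast N.dim_zero i) with h | h <;> simp [GNN.layerWith, h]
  | succ ℓ => exact h.act_nonneg _

theorem layerWith_mem_possible {V : Type*} (h : MonotonicMaxSum N) {G : ColGraph Col δ V}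
    (hG : ∀ v i, G.label v i = 0 ∨ G.label v i = 1) :
    ∀ ℓ ≤ N.L, ∀ v i, N.layerWith h.k G ℓ v i ∈ N.possible ℓ i := by
  intro ℓ hℓ
  rw [← h.layer_eq_layerWith G ℓ hℓ]
  clear hℓ
  induction ℓ with
  | zero =>
    intro v i
    simpa [GNN.layer, GNN.possible] using hG v (Fin.cast N.dim_zero i)
  | succ ℓ ih =>
    intro v i
    refine ⟨_, _, ih v, ?_, rfl⟩
    intro c y hy j
    obtain ⟨u, -, rfl⟩ := Multiset.mem_map.mp hy
    exact ih u j

theorem layerWith_mono {V : Type*} (h : MonotonicMaxSum N) {κ κ' : ℕ → ℕ∞} (hκ : ∀ ℓ, κ ℓ ≤ κ' ℓ)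
    {G : ColGraph Col δ V} (hG : ∀ v i, G.label v i = 0 ∨ G.label v i = 1) :
    ∀ ℓ ≤ N.L, ∀ v i, N.layerWith κ G ℓ v i ≤ N.layerWith κ' G ℓ v i := by
  intro ℓ
  induction ℓ with
  | zero => intro _ v i; exact le_rfl
  | succ ℓ ih =>
    intro hℓ v i
    refine h.monotone_act (h.preact_mono hℓ (ih (by omega) v) (fun c j => ?_) i)
    obtain ⟨I, hI, hc, he⟩ := exists_subset_maxSum_eq (κ ℓ) (G.nbrs c v)
      fun u => N.layerWith κ G ℓ u j
    rw [he]
    exact sum_le_maxSum_of_injOn (e := id) (fun u _ => h.layerWith_nonneg κ' hG ℓ u j)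
      (Set.injOn_id _) (fun i hi => hI hi) (fun u _ => ih (by omega) u j) (hc.trans (hκ ℓ))

/-! ### Existence of least nonzero values -/

theorem possible_nonneg (h : MonotonicMaxSum N) (ℓ : ℕ) (i : Fin (N.dim ℓ)) :
    ∀ z ∈ N.possible ℓ i, 0 ≤ z := by
  intro z hz
  cases ℓ with
  | zero =>
    have hz : z = 0 ∨ z = 1 := hz
    rcases hz with rfl | rfl <;> norm_num
  | succ ℓ =>
    obtain ⟨x, Y, -, -, rfl⟩ := hz
    exact h.act_nonneg _

/-- The possible values are well-ordered: up to the bias, the argument of the activation function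
lies in the additive monoid generated by finitely many well-ordered sets of nonnegative numbers. -/
theorem isPWO_possible (h : MonotonicMaxSum N) :
    ∀ ℓ ≤ N.L, ∀ i, (N.possible ℓ i).IsPWO := by
  intro ℓ
  induction ℓ with
  | zero => intro _ i; exact (Set.toFinite ({0, 1} : Set ℝ)).isPWO
  | succ ℓ ih =>
    intro hℓ i
    set T : Set ℝ := (⋃ j ∈ Finset.univ, (fun y => N.A ℓ i j * y) '' N.possible ℓ j) ∪
      ⋃ c ∈ Finset.univ, ⋃ j ∈ Finset.univ, (fun y => N.B ℓ c i j * y) '' N.possible ℓ j with hTdef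
    have hA : ∀ j, ∀ y ∈ N.possible ℓ j, N.A ℓ i j * y ∈ T := fun j y hy =>
      Or.inl (by simp only [Set.mem_iUnion]; exact ⟨j, Finset.mem_univ _, y, hy, rfl⟩)
    have hB : ∀ c j, ∀ y ∈ N.possible ℓ j, N.B ℓ c i j * y ∈ T := fun c j y hy =>
      Or.inr (by
        simp only [Set.mem_iUnion]
        exact ⟨c, Finset.mem_univ _, j, Finset.mem_univ _, y, hy, rfl⟩)
    have hT0 : ∀ z ∈ T, 0 ≤ z := by
      rintro z (hz | hz)
      · simp only [Set.mem_iUnion] at hz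
        obtain ⟨j, -, y, hy, rfl⟩ := hz
        exact mul_nonneg (h.A_nonneg ℓ hℓ i j) (h.possible_nonneg ℓ j y hy)
      · simp only [Set.mem_iUnion] at hz
        obtain ⟨c, -, j, -, y, hy, rfl⟩ := hz
        exact mul_nonneg (h.B_nonneg ℓ hℓ c i j) (h.possible_nonneg ℓ j y hy)
    have hT : T.IsPWO := by
      refine Set.IsPWO.union ?_ ?_
      · rw [Finset.isPWO_bUnion]
        intro j _
        exact (ih (by omega) j).image_of_monotone fun a b hab =>
          mul_le_mul_of_nonneg_left hab (h.A_nonneg ℓ hℓ i j)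
      · rw [Finset.isPWO_bUnion]
        intro c _
        rw [Finset.isPWO_bUnion]
        intro j _
        exact (ih (by omega) j).image_of_monotone fun a b hab =>
          mul_le_mul_of_nonneg_left hab (h.B_nonneg ℓ hℓ c i j)
    have hM := hT.addSubmonoid_closure hT0
    refine (hM.image_of_monotone (f := fun z => N.act (z + N.bias ℓ i)) fun a b hab =>
      h.monotone_act (by linarith)).mono ?_
    rintro z ⟨x, Y, hx, hY, rfl⟩
    refine ⟨∑ j, N.A ℓ i j * x j + ∑ c, ∑ j, N.B ℓ c i j * N.agg ℓ ((Y c).map fun y => y j), ?_, ?_⟩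
    · refine AddSubmonoid.add_mem _ (AddSubmonoid.sum_mem _ fun j _ =>
        AddSubmonoid.subset_closure (hA j _ (hx j))) (AddSubmonoid.sum_mem _ fun c _ =>
        AddSubmonoid.sum_mem _ fun j _ => ?_)
      rw [h.agg_eq ℓ hℓ]
      obtain ⟨U, hU, -, he⟩ := exists_le_maxSum_eq (h.k ℓ) ((Y c).map fun y => y j)
      have hd : N.B ℓ c i j * U.sum = (U.map fun a => N.B ℓ c i j * a).sum := by
        rw [Multiset.sum_map_mul_left, Multiset.map_id']
      rw [he, hd]
      refine AddSubmonoid.multiset_sum_mem _ _ fun a ha => ?_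
      obtain ⟨b, hb, rfl⟩ := Multiset.mem_map.mp ha
      obtain ⟨y, hy, rfl⟩ := Multiset.mem_map.mp (Multiset.mem_of_le hU hb)
      exact AddSubmonoid.subset_closure (hB c j _ (hY c y hy j))
    · rw [GNN.val_eq_preact]
      rfl

theorem _root_.Set.IsPWO.exists_isLeast {s : Set ℝ} (hs : s.IsPWO) (hne : s.Nonempty) :
    ∃ a, IsLeast s a :=
  ⟨hs.isWF.min hne, hs.isWF.min_mem hne, fun _ hb => hs.isWF.min_le hne hb⟩

theorem exists_isLeast_nonzeroValues (h : MonotonicMaxSum N) {ℓ : ℕ} (hℓ : ℓ ≤ N.L)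
    (hne : (N.nonzeroValues ℓ).Nonempty) : ∃ x, IsLeast (N.nonzeroValues ℓ) x := by
  refine Set.IsPWO.exists_isLeast (Set.IsPWO.mono (t := ⋃ i ∈ Finset.univ, N.possible ℓ i) ?_ ?_) hne
  · rw [Finset.isPWO_bUnion]
    exact fun i _ => h.isPWO_possible ℓ hℓ i
  · rintro z ⟨-, i, hi⟩
    simp only [Set.mem_iUnion]
    exact ⟨i, Finset.mem_univ _, hi⟩

theorem _root_.MaxSumGNN.GNN.exists_isLeast_nonzeroWeights (N : GNN Col δ) {ℓ : ℕ}
    (hne : (N.nonzeroWeights ℓ).Nonempty) : ∃ w, IsLeast (N.nonzeroWeights ℓ) w := by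
  refine Set.IsPWO.exists_isLeast (Set.Finite.isPWO ?_) hne
  refine ((Set.finite_range fun p : Fin (N.dim (ℓ + 1)) × Fin (N.dim ℓ) => N.A ℓ p.1 p.2).union
    (Set.finite_range fun p : Col × Fin (N.dim (ℓ + 1)) × Fin (N.dim ℓ) =>
      N.B ℓ p.1 p.2.1 p.2.2)).subset ?_
  rintro w ⟨-, i, j, rfl | ⟨c, rfl⟩⟩
  · exact Or.inl ⟨(i, j), rfl⟩
  · exact Or.inr ⟨(c, i, j), rfl⟩

end MonotonicMaxSum

/-! ### Bounding the number of summands by the capacity -/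

namespace MonotonicMaxSum

variable {Col : Type*} {δ : ℕ} {N : GNN Col δ}

theorem le_act_leastArg (h : MonotonicMaxSum N) (α : ℝ) : α ≤ N.act (h.leastArg α) := by
  have hne : {n : ℕ | 1 ≤ n ∧ α ≤ N.act n}.Nonempty := by
    obtain ⟨x, hx⟩ := h.act_unbounded α
    refine ⟨⌈x⌉₊ + 1, by omega, hx.le.trans (h.monotone_act ?_)⟩
    push_cast
    linarith [Nat.le_ceil x]
  exact (Nat.sInf_mem hne).2

variable [Fintype Col]

/-- One layer of `layerWith_eq_or_le` in the case where the least nonzero weight `w` and the least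
nonzero value `x` exist: unless the truncated argument reaches `β`, every value that enters it
with a nonzero weight is below `(β - b) / w`, hence exact, and too few values are nonzero for the
truncation to have an effect. -/
theorem preact_eq_or_le {V : Type*} (h : MonotonicMaxSum N) {C : ℕ} {G : ColGraph Col δ V}
    (hG : ∀ v i, G.label v i = 0 ∨ G.label v i = 1) {ℓ : ℕ} (hℓ : ℓ < N.L) {w x β b : ℝ}
    (hw : IsLeast (N.nonzeroWeights ℓ) w) (hx : IsLeast (N.nonzeroValues ℓ) x)
    (hb : ∀ i, b ≤ N.bias ℓ i) (hC : min (h.k ℓ) (⌈(β - b) / (w * x)⌉₊ : ℕ∞) ≤ C)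
    (ih : ∀ v i, N.layerWith (fun ℓ => min C (h.k ℓ)) G ℓ v i = N.layerWith h.k G ℓ v i ∨
      (β - b) / w ≤ N.layerWith (fun ℓ => min C (h.k ℓ)) G ℓ v i)
    (v : V) (i : Fin (N.dim (ℓ + 1))) :
    let z := fun κ : ℕ → ℕ∞ => N.preact ℓ (N.layerWith κ G ℓ v)
      (fun c j => maxSum (κ ℓ) ((G.nbrs c v).val.map fun u => N.layerWith κ G ℓ u j)) i
    z (fun ℓ => min C (h.k ℓ)) = z h.k ∨ β ≤ z (fun ℓ => min C (h.k ℓ)) := by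
  intro z
  by_cases hz : β ≤ z (fun ℓ => min C (h.k ℓ))
  · exact Or.inr hz
  left
  set κ : ℕ → ℕ∞ := fun ℓ => min C (h.k ℓ) with hκ
  push Not at hz
  have hA := h.A_nonneg ℓ hℓ
  have hB := h.B_nonneg ℓ hℓ
  have hv0 := h.layerWith_nonneg κ hG ℓ
  have hm0 : ∀ c j, ∀ a ∈ (G.nbrs c v).val.map fun u => N.layerWith κ G ℓ u j, 0 ≤ a := by
    intro c j a ha
    obtain ⟨u, -, rfl⟩ := Multiset.mem_map.mp ha
    exact hv0 u j
  have hA0 : ∀ j ∈ Finset.univ, 0 ≤ N.A ℓ i j * N.layerWith κ G ℓ v j := fun j _ =>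
    mul_nonneg (hA i j) (hv0 v j)
  have hB0 : ∀ c, ∀ j ∈ Finset.univ, 0 ≤ N.B ℓ c i j *
      maxSum (κ ℓ) ((G.nbrs c v).val.map fun u => N.layerWith κ G ℓ u j) := fun c j _ =>
    mul_nonneg (hB c i j) (maxSum_nonneg _ (hm0 c j))
  have hB1 : ∀ c ∈ Finset.univ, 0 ≤ ∑ j, N.B ℓ c i j *
      maxSum (κ ℓ) ((G.nbrs c v).val.map fun u => N.layerWith κ G ℓ u j) := fun c _ =>
    Finset.sum_nonneg (hB0 c)
  have hz' : ∑ j, N.A ℓ i j * N.layerWith κ G ℓ v j + ∑ c, ∑ j, N.B ℓ c i j *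
      maxSum (κ ℓ) ((G.nbrs c v).val.map fun u => N.layerWith κ G ℓ u j) < β - b := by
    have : z κ < β := hz
    simp only [z, GNN.preact] at this
    linarith [hb i]
  have hw0 : 0 < w := by
    refine lt_of_le_of_ne ?_ hw.1.1.symm
    obtain ⟨i, j, h1 | ⟨c, h1⟩⟩ := hw.1.2
    · rw [h1]; exact hA i j
    · rw [h1]; exact hB c i j
  have hx0 : 0 < x := by
    refine lt_of_le_of_ne ?_ hx.1.1.symm
    obtain ⟨i, hi⟩ := hx.1.2
    exact h.possible_nonneg ℓ i _ hi
  have hpos : 0 < β - b := lt_of_le_of_lt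
    (add_nonneg (Finset.sum_nonneg hA0) (Finset.sum_nonneg hB1)) hz'
  -- an entry of the argument with a nonzero weight is less than `(β - b) / w`
  have key : ∀ a y : ℝ, a ∈ N.nonzeroWeights ℓ → 0 ≤ y → a * y < β - b → y < (β - b) / w := by
    intro a y ha hy hlt
    rw [lt_div_iff₀ hw0]
    nlinarith [hw.2 ha]
  have hex : ∀ u j, N.layerWith κ G ℓ u j < (β - b) / w →
      N.layerWith κ G ℓ u j = N.layerWith h.k G ℓ u j := fun u j hlt =>
    (ih u j).resolve_right (not_le.mpr hlt)
  simp only [z, GNN.preact]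
  congr 2
  · refine Finset.sum_congr rfl fun j _ => ?_
    rcases eq_or_ne (N.A ℓ i j) 0 with h0 | h0
    · simp [h0]
    · rw [hex v j (key _ _ ⟨h0, i, j, Or.inl rfl⟩ (hv0 v j) ?_)]
      have h1 := Finset.single_le_sum hA0 (Finset.mem_univ j)
      have h2 := Finset.sum_nonneg hB1
      linarith
  · refine Finset.sum_congr rfl fun c _ => Finset.sum_congr rfl fun j _ => ?_
    rcases eq_or_ne (N.B ℓ c i j) 0 with h0 | h0
    · simp [h0]
    congr 1
    have hlt := key _ _ ⟨h0, i, j, Or.inr ⟨c, rfl⟩⟩ (maxSum_nonneg (κ ℓ) (hm0 c j)) (by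
      have h1 := Finset.single_le_sum (hB0 c) (Finset.mem_univ j)
      have h2 := Finset.single_le_sum hB1 (Finset.mem_univ c)
      have h3 := Finset.sum_nonneg hA0
      linarith)
    rcases Nat.eq_zero_or_pos C with hC0 | hC0
    · -- the rounded-up quotient is positive, so only `k ℓ = 0` is left
      have hk : h.k ℓ = 0 := by
        have hc : 0 < ⌈(β - b) / (w * x)⌉₊ := Nat.ceil_pos.mpr (by positivity)
        rw [hC0] at hC
        rcases min_le_iff.mp hC with h1 | h1
        · simpa using h1
        · norm_cast at h1; omega
      simp [hκ, hk, maxSum]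
    rcases eq_or_ne (h.k ℓ) 0 with hk0 | hk0
    · simp [hκ, hk0, maxSum]
    have h1κ : 1 ≤ κ ℓ := le_min (by exact_mod_cast hC0) (Order.one_le_iff_ne_zero.mpr hk0)
    have hall : ∀ u ∈ G.nbrs c v, N.layerWith κ G ℓ u j = N.layerWith h.k G ℓ u j := fun u hu =>
      hex u j (lt_of_le_of_lt (le_maxSum_of_mem h1κ (hm0 c j)
        (Multiset.mem_map.mpr ⟨u, hu, rfl⟩)) hlt)
    have hmap : ((G.nbrs c v).val.map fun u => N.layerWith κ G ℓ u j) =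
        (G.nbrs c v).val.map fun u => N.layerWith h.k G ℓ u j :=
      Multiset.map_congr rfl hall
    have hmk := hm0 c j
    rw [hmap] at hlt hmk ⊢
    rcases le_or_gt (h.k ℓ) C with hkC | hkC
    · rw [show κ ℓ = h.k ℓ from min_eq_right hkC]
    · have hκC : κ ℓ = C := min_eq_left hkC.le
      rw [hκC] at hlt ⊢
      refine maxSum_eq_of_lt hkC.le hmk (x := x) ?_ (hlt.trans_le ?_)
      · intro a ha ha0
        obtain ⟨u, -, rfl⟩ := Multiset.mem_map.mp ha
        exact hx.2 ⟨ha0, j, h.layerWith_mem_possible hG ℓ hℓ.le u j⟩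
      · have hceil : ⌈(β - b) / (w * x)⌉₊ ≤ C := by
          rcases min_le_iff.mp hC with h1 | h1
          · exact absurd h1 (not_le.mpr hkC)
          · exact_mod_cast h1
        have := Nat.ceil_le.mp hceil
        rw [div_le_iff₀ (by positivity)] at this
        rw [div_le_iff₀ hw0]
        linarith

/-- If `C` is at least the capacities of the layers `1, …, ℓ` for the target value `α` in layer `ℓ`,
then truncating the aggregations to `C` summands changes only values that stay at least `α`. -/
theorem layerWith_eq_or_le {V : Type*} (h : MonotonicMaxSum N) {C : ℕ} {G : ColGraph Col δ V}
    (hG : ∀ v i, G.label v i = 0 ∨ G.label v i = 1) :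
    ∀ ℓ ≤ N.L, ∀ α : ℝ, (∀ m, 1 ≤ m → m ≤ ℓ → h.capacityPass ℓ α m ≤ C) → ∀ v i,
      N.layerWith (fun ℓ => min C (h.k ℓ)) G ℓ v i = N.layerWith h.k G ℓ v i ∨
        α ≤ N.layerWith (fun ℓ => min C (h.k ℓ)) G ℓ v i := by
  intro ℓ
  induction ℓ with
  | zero => exact fun _ _ _ _ _ => Or.inl rfl
  | succ ℓ ih =>
    intro hℓ α hcap v i
    by_cases hcond : (∃ w, IsLeast (N.nonzeroWeights ℓ) w) ∧ (∃ x, IsLeast (N.nonzeroValues ℓ) x)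
    · obtain ⟨⟨w, hw⟩, ⟨x, hx⟩⟩ := id hcond
      have hcap' : ∀ m, h.capacityPass (ℓ + 1) α m =
          if m = ℓ + 1 then (min (h.k ℓ)
            ((⌈((h.leastArg α : ℝ) - ⨅ i, N.bias ℓ i) / (w * x)⌉₊ : ℕ) : ℕ∞)).toNat
          else h.capacityPass ℓ (((h.leastArg α : ℝ) - ⨅ i, N.bias ℓ i) / w) m := by
        intro m
        rw [capacityPass, if_pos hcond, hw.csInf_eq, hx.csInf_eq]
      have hC : min (h.k ℓ) ((⌈((h.leastArg α : ℝ) - ⨅ i, N.bias ℓ i) / (w * x)⌉₊ : ℕ) : ℕ∞)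
          ≤ C := by
        have h1 := hcap (ℓ + 1) (by omega) le_rfl
        rw [hcap', if_pos rfl] at h1
        rw [← ENat.natCast_toNat (ne_top_of_le_ne_top (ENat.natCast_ne_top _) (min_le_right _ _))]
        exact_mod_cast h1
      rcases h.preact_eq_or_le hG hℓ hw hx
        (fun i => ciInf_le (Set.finite_range _).bddBelow i) hC (ih (by omega) _ fun m h1 h2 => by
          have h3 := hcap m h1 (by omega)
          rwa [hcap', if_neg (by omega)] at h3) v i with h1 | h1
      · exact Or.inl (congrArg N.act h1)
      · exact Or.inr ((h.le_act_leastArg α).trans (h.monotone_act h1))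
    · left
      simp only [GNN.layerWith]
      congr 1
      rcases not_and_or.mp hcond with h1 | h1
      · -- all weights vanish, so layer `ℓ` has no influence
        have hw : ∀ a, ∀ i j, (a = N.A ℓ i j ∨ ∃ c, a = N.B ℓ c i j) → a = 0 := by
          intro a i j ha
          by_contra ha0
          exact h1 (N.exists_isLeast_nonzeroWeights ⟨a, ha0, i, j, ha⟩)
        have hA : ∀ i j, N.A ℓ i j = 0 := fun i j => hw _ i j (Or.inl rfl)
        have hB : ∀ c i j, N.B ℓ c i j = 0 := fun c i j => hw _ i j (Or.inr ⟨c, rfl⟩)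
        simp [GNN.preact, hA, hB]
      · have hv : ∀ u j, N.layerWith h.k G ℓ u j = 0 := by
          intro u j
          by_contra h0
          exact h1 (h.exists_isLeast_nonzeroValues (by omega)
            ⟨_, h0, j, h.layerWith_mem_possible hG ℓ (by omega) u j⟩)
        have hv' : ∀ u j, N.layerWith (fun ℓ => min C (h.k ℓ)) G ℓ u j = 0 := fun u j =>
          le_antisymm ((h.layerWith_mono (fun _ => min_le_right _ _) hG ℓ (by omega) u j).trans_eq
            (hv u j)) (h.layerWith_nonneg _ hG ℓ u j)
        simp only [hv, hv']
        have hm : ∀ (k : ℕ∞) (s : Finset V), maxSum k (s.val.map fun _ => (0 : ℝ)) = 0 := by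
          intro k s
          obtain ⟨I, -, -, he⟩ := exists_subset_maxSum_eq k s fun _ => (0 : ℝ)
          simpa using he
        simp only [GNN.preact, hm, hv, hv']

/-- Replacing the numbers `k ℓ` by their minima with the capacity does not make the value of a
vertex drop below the threshold. -/
theorem threshold_le_layerWith {V : Type*} (h : MonotonicMaxSum N) {G : ColGraph Col δ V}
    (hG : ∀ v i, G.label v i = 0 ∨ G.label v i = 1) {v : V} {i : Fin (N.dim N.L)}
    (hv : h.threshold ≤ N.layerWith h.k G N.L v i) :
    h.threshold ≤ N.layerWith (fun ℓ => min h.capacity (h.k ℓ)) G N.L v i := by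
  rcases h.layerWith_eq_or_le (C := h.capacity) hG N.L le_rfl h.threshold
    (fun m h1 h2 => Finset.le_sup (f := h.layerCapacity) (Finset.mem_Icc.mpr ⟨h1, h2⟩)) v i
    with h1 | h1
  · rwa [h1]
  · exact h1

end MonotonicMaxSum

/-! ### Tree-like formulas with prescribed numbers of children -/

section TreeForm

variable {Col : Type*} {δ : ℕ} {Var K : Type*}

theorem conjVars_empty : conjVars (∅ : Set (Literal Col δ (Term Var K))) = ∅ := by
  simp [conjVars]

theorem conjVars_union (φ ψ : Set (Literal Col δ (Term Var K))) :
    conjVars (φ ∪ ψ) = conjVars φ ∪ conjVars ψ := by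
  ext x
  simp only [conjVars, Set.mem_union, Set.mem_ofPred_eq, or_and_right, exists_or]

theorem conjVars_iUnion {I : Sort*} (φ : I → Set (Literal Col δ (Term Var K))) :
    conjVars (⋃ i, φ i) = ⋃ i, conjVars (φ i) := by
  ext x
  simp only [conjVars, Set.mem_iUnion, Set.mem_ofPred_eq]
  constructor
  · rintro ⟨l, ⟨i, hi⟩, h⟩
    exact ⟨i, l, hi, h⟩
  · rintro ⟨i, l, hi, h⟩
    exact ⟨l, ⟨i, hi⟩, h⟩

theorem conjVars_unaryLit (i : Fin δ) (x : Var) :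
    conjVars ({unaryLit i x} : Set (Literal Col δ (Term Var K))) = {x} := by
  ext z
  simp [conjVars, unaryLit, Literal.args, Atom.args, Term.vars]

theorem conjVars_edgeLit (c : Col) (x y : Var) :
    conjVars ({edgeLit c x y} : Set (Literal Col δ (Term Var K))) = {x, y} := by
  ext z
  simp [conjVars, edgeLit, Literal.args, Atom.args, Term.vars]

theorem conjVars_neLit (x y : Var) :
    conjVars ({neLit x y} : Set (Literal Col δ (Term Var K))) = {x, y} := by
  ext z
  simp [conjVars, neLit, Literal.args, Term.vars]

theorem mem_conjVars_iff {φ : Set (Literal Col δ (Term Var K))} {x : Var} :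
    x ∈ conjVars φ ↔ ∃ l ∈ φ, x ∈ conjVars ({l} : Set (Literal Col δ (Term Var K))) := by
  simp [conjVars]

theorem TreeLike.biUnion {I : Type*} (x : Var) (s : Finset I)
    (φ : I → Set (Literal Col δ (Term Var K))) (h : ∀ i ∈ s, TreeLike x (φ i))
    (hd : ∀ i j, i ≠ j → conjVars (φ i) ∩ conjVars (φ j) ⊆ {x}) : TreeLike x (⋃ i ∈ s, φ i) := by
  classical
  induction s using Finset.induction_on with
  | empty => simpa using TreeLike.top x
  | insert a s ha ih =>
    rw [Finset.set_biUnion_insert]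
    refine TreeLike.and x _ _ (h a (by simp)) (ih fun i hi => h i (by simp [hi])) ?_
    rintro y ⟨h1, h2⟩
    simp only [conjVars_iUnion, Set.mem_iUnion] at h2
    obtain ⟨i, hi, h2⟩ := h2
    exact hd a i (fun he => ha (he ▸ hi)) ⟨h1, h2⟩

/-- There is a chain of `n` edge conjuncts of `φ` from `x` to `y`. -/
def EdgePath (φ : Set (Literal Col δ (Term Var K))) (n : ℕ) (x y : Var) : Prop :=
  ∃ p : ℕ → Var, p 0 = x ∧ p n = y ∧ ∀ i < n, ∃ c : Col, edgeLit c (p i) (p (i + 1)) ∈ φ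

theorem EdgePath.mono {φ ψ : Set (Literal Col δ (Term Var K))} (h : φ ⊆ ψ) {n : ℕ} {x y : Var} :
    EdgePath φ n x y → EdgePath ψ n x y := by
  rintro ⟨p, h0, hn, hp⟩
  exact ⟨p, h0, hn, fun i hi => (hp i hi).imp fun c hc => h hc⟩

theorem EdgePath.cons {φ : Set (Literal Col δ (Term Var K))} {n : ℕ} {x y z : Var} {c : Col}
    (hc : edgeLit c x y ∈ φ) : EdgePath φ n y z → EdgePath φ (n + 1) x z := by
  rintro ⟨p, h0, hn, hp⟩
  refine ⟨fun i => Nat.casesOn i x p, rfl, hn, ?_⟩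
  rintro (_ | i) hi
  · exact ⟨c, by simpa [h0] using hc⟩
  · exact hp i (by omega)

theorem TreeLike.exists_edgePath {x : Var} {φ : Set (Literal Col δ (Term Var K))}
    (h : TreeLike x φ) : ∀ y ∈ conjVars φ, ∃ n, EdgePath φ n x y := by
  have refl : ∀ (φ : Set (Literal Col δ (Term Var K))) x, EdgePath φ 0 x x := fun φ x =>
    ⟨fun _ => x, rfl, rfl, by simp⟩
  induction h with
  | top x => simp [conjVars_empty]
  | unary x i =>
    intro y hy
    rw [conjVars_unaryLit] at hy
    exact ⟨0, hy ▸ refl _ _⟩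
  | and x φ₁ φ₂ _ _ _ ih₁ ih₂ =>
    intro y hy
    rw [conjVars_union] at hy
    rcases hy with hy | hy
    · exact (ih₁ y hy).imp fun n => EdgePath.mono Set.subset_union_left
    · exact (ih₂ y hy).imp fun n => EdgePath.mono Set.subset_union_right
  | count x c n y φ _ _ _ _ ih =>
    intro z hz
    set ψ := (⋃ i, insert (edgeLit c x (y i)) (φ i)) ∪
        {l | ∃ i j, i < j ∧ l = neLit (y i) (y j)} with hψ
    have hsub : ∀ i, insert (edgeLit c x (y i)) (φ i) ⊆ ψ := fun i l hl =>
      Or.inl (Set.mem_iUnion.mpr ⟨i, hl⟩)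
    have hy : ∀ i, EdgePath ψ 1 x (y i) := fun i =>
      EdgePath.cons (hsub i (Set.mem_insert _ _)) (refl _ _)
    rw [mem_conjVars_iff] at hz
    obtain ⟨l, hl | ⟨i, j, -, rfl⟩, hz⟩ := hz
    · obtain ⟨i, rfl | hl⟩ := Set.mem_iUnion.mp hl
      · rw [conjVars_edgeLit] at hz
        rcases hz with rfl | rfl
        · exact ⟨0, refl _ _⟩
        · exact ⟨1, hy i⟩
      · obtain ⟨m, hm⟩ := ih i z (mem_conjVars_iff.mpr ⟨l, hl, hz⟩)
        exact ⟨m + 1, EdgePath.cons (hsub i (Set.mem_insert _ _))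
          (hm.mono ((Set.subset_insert _ _).trans (hsub i)))⟩
    · rw [conjVars_neLit] at hz
      rcases hz with rfl | rfl
      · exact ⟨1, hy i⟩
      · exact ⟨1, hy j⟩

variable (ι : List (ℕ × Col × ℕ) → Var) (U : List (ℕ × Col × ℕ) → Set (Fin δ))
  (n : ℕ → Col → List (ℕ × Col × ℕ) → ℕ)

/-- The conjunct of `treeForm` for the children in layer `ℓ` and of colour `c` of the node `p`,
where `φ i` is the formula of the child number `i`. -/
def countForm (ℓ : ℕ) (c : Col) (p : List (ℕ × Col × ℕ))
    (φ : ℕ → Set (Literal Col δ (Term Var K))) : Set (Literal Col δ (Term Var K)) :=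
  (⋃ i : Fin (n ℓ c p), insert (edgeLit c (ι p) (ι ((ℓ, c, (i : ℕ)) :: p))) (φ i)) ∪
    {l | ∃ i j : Fin (n ℓ c p), i < j ∧
      l = neLit (ι ((ℓ, c, (i : ℕ)) :: p)) (ι ((ℓ, c, (j : ℕ)) :: p))}

/-- The tree-like formula that describes the part of a dataset on which the value of a vertex in
layer `ℓ` depends. The nodes of the tree are lists: the root is `[]`, and `(k, c, i) :: p` is
the child of `p` that stands for the neighbour number `i` of colour `c` whose value in layer `k`
is used for the value of `p` in layer `k + 1`. The variable of the node `p` is `ι p`, its labels are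
`U p`, and `n k c p` is the number of its children in layer `k` and of colour `c`. -/
def treeForm : ℕ → List (ℕ × Col × ℕ) → Set (Literal Col δ (Term Var K))
  | 0, p => ⋃ i ∈ U p, {unaryLit i (ι p)}
  | ℓ + 1, p => treeForm ℓ p ∪
      ⋃ c, countForm ι n ℓ c p fun i => treeForm ℓ ((ℓ, c, i) :: p)

variable {ι U n}

theorem mem_conjVars_countForm {ℓ : ℕ} {c : Col} {p : List (ℕ × Col × ℕ)}
    {φ : ℕ → Set (Literal Col δ (Term Var K))} {x : Var}
    (hx : x ∈ conjVars (countForm ι n ℓ c p φ)) :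
    x = ι p ∨ ∃ i, x = ι ((ℓ, c, i) :: p) ∨ x ∈ conjVars (φ i) := by
  obtain ⟨l, hl | ⟨i, j, -, rfl⟩, hx⟩ := mem_conjVars_iff.mp hx
  · obtain ⟨i, rfl | hl⟩ := Set.mem_iUnion.mp hl
    · rw [conjVars_edgeLit] at hx
      exact hx.imp id fun h => ⟨i, Or.inl h⟩
    · exact Or.inr ⟨i, Or.inr (mem_conjVars_iff.mpr ⟨l, hl, hx⟩)⟩
  · rw [conjVars_neLit] at hx
    rcases hx with h | h
    · exact Or.inr ⟨i, Or.inl h⟩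
    · exact Or.inr ⟨j, Or.inl h⟩

theorem mem_conjVars_treeForm : ∀ {ℓ : ℕ} {p : List (ℕ × Col × ℕ)} {x : Var},
    x ∈ conjVars (treeForm (K := K) ι U n ℓ p) →
      x = ι p ∨ ∃ r s, s.1 < ℓ ∧ x = ι (r ++ s :: p) := by
  intro ℓ
  induction ℓ with
  | zero =>
    intro p x hx
    simp only [treeForm, conjVars_iUnion, conjVars_unaryLit, Set.mem_iUnion] at hx
    obtain ⟨_, _, hx⟩ := hx
    exact Or.inl hx
  | succ ℓ ih =>
    intro p x hx
    simp only [treeForm, conjVars_union, conjVars_iUnion, Set.mem_union, Set.mem_iUnion] at hx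
    rcases hx with hx | ⟨c, hx⟩
    · rcases ih hx with rfl | ⟨r, s, hs, rfl⟩
      · exact Or.inl rfl
      · exact Or.inr ⟨r, s, by omega, rfl⟩
    · rcases mem_conjVars_countForm hx with rfl | ⟨i, rfl | hx⟩
      · exact Or.inl rfl
      · exact Or.inr ⟨[], (ℓ, c, i), by simp, rfl⟩
      · rcases ih hx with rfl | ⟨r, s, -, rfl⟩
        · exact Or.inr ⟨[], (ℓ, c, i), by simp, rfl⟩
        · exact Or.inr ⟨r ++ [s], (ℓ, c, i), by simp, by simp⟩

theorem mem_insert_conjVars_treeForm {ℓ : ℕ} {p : List (ℕ × Col × ℕ)} {x : Var}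
    (hx : x ∈ insert (ι p) (conjVars (treeForm (K := K) ι U n ℓ p))) : ∃ r, x = ι (r ++ p) := by
  rcases hx with rfl | hx
  · exact ⟨[], rfl⟩
  · rcases mem_conjVars_treeForm hx with rfl | ⟨r, s, -, rfl⟩
    · exact ⟨[], rfl⟩
    · exact ⟨r ++ [s], by simp⟩

theorem eq_of_append_cons_eq {α : Type*} {r r' p : List α} {s s' : α}
    (h : r ++ s :: p = r' ++ s' :: p) : s = s' := by
  have h' : (r ++ [s]) ++ p = (r' ++ [s']) ++ p := by simpa using h
  have := List.append_cancel_right h'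
  exact (List.append_inj' this rfl).2 |> fun h => by simpa using h

theorem treeLike_treeForm [Fintype Col] (hι : Function.Injective ι) :
    ∀ (ℓ : ℕ) (p : List (ℕ × Col × ℕ)), TreeLike (ι p) (treeForm (K := K) ι U n ℓ p) := by
  classical
  intro ℓ
  induction ℓ with
  | zero =>
    intro p
    have := TreeLike.biUnion (ι p) (Finset.univ.filter (· ∈ U p))
      (fun i => ({unaryLit i (ι p)} : Set (Literal Col δ (Term Var K))))
      (fun i _ => TreeLike.unary _ i) (fun i j _ => by
        rw [conjVars_unaryLit]
        exact Set.inter_subset_left)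
    simpa [treeForm] using this
  | succ ℓ ih =>
    intro p
    have hc : ∀ c, TreeLike (ι p) (countForm ι n ℓ c p
        fun i => treeForm (K := K) ι U n ℓ ((ℓ, c, i) :: p)) := by
      intro c
      refine TreeLike.count (ι p) c (n ℓ c p) (fun i => ι ((ℓ, c, (i : ℕ)) :: p))
        (fun i => treeForm ι U n ℓ ((ℓ, c, (i : ℕ)) :: p)) ?_ (fun i => ih _) ?_ ?_
      · intro i j hij
        simpa [Fin.ext_iff] using hι hij
      · intro i hi
        obtain ⟨r, hr⟩ := mem_insert_conjVars_treeForm hi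
        have := congrArg List.length (hι hr)
        simp at this
        omega
      · intro i j hij
        rw [Set.disjoint_left]
        intro x h1 h2
        obtain ⟨r, rfl⟩ := mem_insert_conjVars_treeForm h1
        obtain ⟨r', hr⟩ := mem_insert_conjVars_treeForm h2
        have := eq_of_append_cons_eq (hι hr)
        simp only [Prod.mk.injEq, true_and] at this
        exact hij (Fin.ext this)
    have hv : ∀ c x, x ∈ conjVars (countForm ι n ℓ c p
        fun i => treeForm (K := K) ι U n ℓ ((ℓ, c, i) :: p)) →
        x = ι p ∨ ∃ r i, x = ι (r ++ (ℓ, c, i) :: p) := by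
      intro c x hx
      rcases mem_conjVars_countForm hx with h | ⟨i, hx⟩
      · exact Or.inl h
      · obtain ⟨r, hr⟩ := mem_insert_conjVars_treeForm (ι := ι) (x := x) hx
        exact Or.inr ⟨r, i, hr⟩
    refine TreeLike.and (ι p) _ _ (ih p) ?_ ?_
    · have := TreeLike.biUnion (ι p) Finset.univ (fun c => countForm ι n ℓ c p
        fun i => treeForm (K := K) ι U n ℓ ((ℓ, c, i) :: p)) (fun c _ => hc c) ?_
      · simpa using this
      · rintro c c' hcc x ⟨h1, h2⟩
        rcases hv c x h1 with rfl | ⟨r, i, rfl⟩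
        · rfl
        · rcases hv c' _ h2 with h | ⟨r', i', h⟩
          · exact h
          · have := eq_of_append_cons_eq (hι h)
            simp only [Prod.mk.injEq] at this
            exact absurd this.2.1 hcc
    · rintro x ⟨h1, h2⟩
      rw [conjVars_iUnion] at h2
      obtain ⟨c, h2⟩ := Set.mem_iUnion.mp h2
      rcases mem_conjVars_treeForm h1 with rfl | ⟨r, s, hs, rfl⟩
      · rfl
      · rcases hv c _ h2 with h | ⟨r', i', h⟩
        · exact h
        · have := eq_of_append_cons_eq (hι h)
          rw [this] at hs
          exact absurd hs (lt_irrefl _)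

theorem finite_treeForm [Finite Col] : ∀ (ℓ : ℕ) (p : List (ℕ × Col × ℕ)),
    (treeForm (K := K) ι U n ℓ p).Finite := by
  intro ℓ
  induction ℓ with
  | zero => exact fun p => (Set.toFinite (U p)).biUnion fun _ _ => Set.finite_singleton _
  | succ ℓ ih =>
    intro p
    refine (ih p).union (Set.finite_iUnion fun c => Set.Finite.union
      (Set.finite_iUnion fun i => (ih _).insert _) ?_)
    refine (Set.finite_range fun q : Fin (n ℓ c p) × Fin (n ℓ c p) =>
      neLit (ι ((ℓ, c, (q.1 : ℕ)) :: p)) (ι ((ℓ, c, (q.2 : ℕ)) :: p))).subset ?_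
    rintro l ⟨i, j, -, rfl⟩
    exact ⟨(i, j), rfl⟩

/-- The edge conjuncts lead from a node to a child. The layer of the child is bounded in terms of
the depth of the node, which makes the fan-out decrease with the depth. -/
theorem edgeLit_mem_treeForm : ∀ {ℓ : ℕ} {p : List (ℕ × Col × ℕ)} {c : Col} {x y : Var},
    edgeLit c x y ∈ treeForm (K := K) ι U n ℓ p →
      ∃ r k i, x = ι (r ++ p) ∧ y = ι ((k, c, i) :: (r ++ p)) ∧ k + r.length < ℓ ∧
        i < n k c (r ++ p) := by
  intro ℓ
  induction ℓ with
  | zero =>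
    intro p c x y h
    simp [treeForm, edgeLit, unaryLit] at h
  | succ ℓ ih =>
    rintro p c x y (h | h)
    · obtain ⟨r, k, i, h1, h2, h3, h4⟩ := ih h
      exact ⟨r, k, i, h1, h2, by omega, h4⟩
    · obtain ⟨c', h | ⟨i, j, -, h⟩⟩ := Set.mem_iUnion.mp h
      · obtain ⟨i, h | h⟩ := Set.mem_iUnion.mp h
        · simp only [edgeLit, Literal.atom.injEq, Atom.edge.injEq, Term.var.injEq] at h
          obtain ⟨rfl, rfl, rfl⟩ := h
          exact ⟨[], ℓ, i, rfl, rfl, by simp, i.2⟩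
        · obtain ⟨r, k, j, h1, h2, h3, h4⟩ := ih h
          exact ⟨r ++ [(ℓ, c', (i : ℕ))], k, j, by simpa using h1, by simpa using h2,
            by simp; omega, by simpa using h4⟩
      · simp [edgeLit, neLit] at h

/-- A chain of edge conjuncts moves down the tree by one node per step. -/
theorem length_of_edgePath_treeForm (hι : Function.Injective ι) {ℓ : ℕ} :
    ∀ {m : ℕ} {q : List (ℕ × Col × ℕ)} {y : Var},
      EdgePath (treeForm (K := K) ι U n ℓ []) m (ι q) y →
        ∃ r, y = ι r ∧ r.length = q.length + m ∧ (m ≠ 0 → r.length ≤ ℓ) := by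
  rintro m q y ⟨P, h0, rfl, hP⟩
  induction m with
  | zero => exact ⟨q, h0, by simp, by simp⟩
  | succ m ih =>
    obtain ⟨r, hr, hl, -⟩ := ih fun i hi => hP i (by omega)
    obtain ⟨c, hc⟩ := hP m (by omega)
    obtain ⟨r', k, i, h1, h2, h3, -⟩ := edgeLit_mem_treeForm hc
    simp only [List.append_nil] at h1 h2
    obtain rfl : r = r' := hι (hr.symm.trans h1)
    exact ⟨_, h2, by simp; omega, fun _ => by simp; omega⟩

theorem hasDepth_treeForm [Fintype Col] (hι : Function.Injective ι) {ℓ : ℕ} {y : Var}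
    (hy : y ∈ conjVars (treeForm (K := K) ι U n ℓ [])) :
    ∃ q, y = ι q ∧ q.length ≤ ℓ ∧ HasDepth (treeForm (K := K) ι U n ℓ []) y q.length := by
  obtain ⟨m, hm⟩ := (treeLike_treeForm hι ℓ []).exists_edgePath y hy
  obtain ⟨q, rfl, hq, hql⟩ := length_of_edgePath_treeForm hι hm
  simp only [List.length_nil, zero_add] at hq
  subst hq
  refine ⟨q, rfl, ?_, ?_, ?_⟩
  · rcases eq_or_ne q.length 0 with h | h
    · omega
    · exact hql h
  · obtain ⟨P, -, h1, h2⟩ := hm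
    exact ⟨P, h1, h2⟩
  · rintro m' ⟨P, h1, h2⟩
    rcases Nat.eq_zero_or_pos m' with rfl | h0
    · exact Nat.zero_le _
    obtain ⟨c, hc⟩ := h2 0 h0
    obtain ⟨r, k, i, h3, -⟩ := edgeLit_mem_treeForm hc
    obtain ⟨q', hq', hl, -⟩ := length_of_edgePath_treeForm hι ⟨P, h3, h1, h2⟩
    rw [hι hq']
    omega

theorem fanOut_treeForm_le [Fintype Col] (hι : Function.Injective ι) {d : ℕ}
    (hn : ∀ k c p, n k c p ≤ d) (ℓ : ℕ) (q : List (ℕ × Col × ℕ)) :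
    fanOut (treeForm (K := K) ι U n ℓ []) (ι q) ≤ Fintype.card Col * d * (ℓ - q.length) := by
  classical
  set S : Finset (ℕ × Col × ℕ) :=
    Finset.range (ℓ - q.length) ×ˢ (Finset.univ : Finset Col) ×ˢ Finset.range d with hS
  have hsub : {y : Var | ∃ c : Col, edgeLit c (ι q) y ∈ treeForm (K := K) ι U n ℓ []} ⊆
      ((S.image fun s => ι (s :: q) : Finset Var) : Set Var) := by
    rintro y ⟨c, hc⟩
    obtain ⟨r, k, i, h1, h2, h3, h4⟩ := edgeLit_mem_treeForm hc
    simp only [List.append_nil] at h1 h2 h4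
    obtain rfl := hι h1
    rw [Finset.mem_coe, Finset.mem_image]
    refine ⟨(k, c, i), ?_, h2.symm⟩
    simp only [hS, Finset.mem_product, Finset.mem_range, Finset.mem_univ, true_and]
    exact ⟨by omega, h4.trans_le (hn _ _ _)⟩
  calc fanOut (treeForm (K := K) ι U n ℓ []) (ι q)
      ≤ (S.image fun s => ι (s :: q)).card := by
        rw [← Set.ncard_coe_finset]
        exact Set.ncard_le_ncard hsub (Finset.finite_toSet _)
    _ ≤ S.card := Finset.card_image_le
    _ = Fintype.card Col * d * (ℓ - q.length) := by
        simp only [hS, Finset.card_product, Finset.card_range, Finset.card_univ]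
        ring

end TreeForm

/-! ### Renaming of variables -/

section Rename

variable {Col : Type*} {δ : ℕ} {Var K : Type*}

theorem map_subst_congr {l : Literal Col δ (Term Var K)} {μ ν : Var → K}
    (h : ∀ x ∈ conjVars ({l} : Set (Literal Col δ (Term Var K))), μ x = ν x) :
    l.map (Term.subst μ) = l.map (Term.subst ν) := by
  have ht : ∀ t ∈ l.args, t.subst μ = t.subst ν := by
    rintro (x | a) ht
    · exact h x ⟨l, rfl, _, ht, rfl⟩
    · rfl
  rcases l with (⟨i, t⟩ | ⟨c, t, s⟩) | ⟨t, s⟩ <;>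
    simp_all [Literal.map, Literal.args, Atom.map, Atom.args]

theorem map_rename_map_subst (l : Literal Col δ (Term Var K)) (ρ : Var → Var) (ν : Var → K) :
    (l.map (Term.rename ρ)).map (Term.subst ν) = l.map (Term.subst (ν ∘ ρ)) := by
  have ht : ∀ t : Term Var K, (t.rename ρ).subst ν = t.subst (ν ∘ ρ) := by
    rintro (x | a) <;> rfl
  rcases l with (⟨i, t⟩ | ⟨c, t, s⟩) | ⟨t, s⟩ <;> simp [Literal.map, Atom.map, ht]

theorem conjVars_image_rename (ρ : Var → Var) (φ : Set (Literal Col δ (Term Var K))) :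
    conjVars ((fun l => l.map (Term.rename ρ)) '' φ) = ρ '' conjVars φ := by
  have hl : ∀ l : Literal Col δ (Term Var K), conjVars {l.map (Term.rename ρ)} =
      ρ '' conjVars {l} := by
    have hv : ∀ t : Term Var K, (t.rename ρ).vars = ρ '' t.vars := by
      rintro (x | a) <;> simp [Term.rename, Term.vars]
    have hc : ∀ l : Literal Col δ (Term Var K), conjVars {l} = ⋃ t ∈ l.args, t.vars := by
      intro l
      ext x
      simp [conjVars]
    intro l
    rw [hc, hc]
    rcases l with (⟨i, t⟩ | ⟨c, t, s⟩) | ⟨t, s⟩ <;>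
      simp [Literal.map, Atom.map, Literal.args, Atom.args, hv, Set.image_union]
  ext x
  constructor
  · intro hx
    obtain ⟨_, ⟨l, hlφ, rfl⟩, hx⟩ := mem_conjVars_iff.mp hx
    rw [hl] at hx
    obtain ⟨y, hy, rfl⟩ := hx
    exact ⟨y, mem_conjVars_iff.mpr ⟨l, hlφ, hy⟩, rfl⟩
  · rintro ⟨y, hy, rfl⟩
    obtain ⟨l, hlφ, hy⟩ := mem_conjVars_iff.mp hy
    exact mem_conjVars_iff.mpr ⟨_, ⟨l, hlφ, rfl⟩, by rw [hl]; exact ⟨y, hy, rfl⟩⟩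

theorem Rule.mem_vars_of_mem_body {r : Rule Col δ Var K} {l : Literal Col δ (Term Var K)}
    (hl : l ∈ r.body) {x : Var} (hx : x ∈ conjVars ({l} : Set (Literal Col δ (Term Var K)))) :
    x ∈ r.vars :=
  Or.inl (mem_conjVars_iff.mpr ⟨l, hl, hx⟩)

theorem Rule.EqUpToRenaming.consequences_eq [Nonempty Var] {r r' : Rule Col δ Var K}
    (h : r.EqUpToRenaming r') (D : Dataset Col δ K) : r.consequences D = r'.consequences D := by
  obtain ⟨ρ, hρ, hbody, hhead⟩ := h
  have hmem : ∀ l ∈ r.body, l.map (Term.rename ρ) ∈ r'.body := fun l hl => by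
    have : l.map (Term.rename ρ) ∈ (r'.body : Set (Literal Col δ (Term Var K))) := by
      rw [← hbody]
      exact ⟨l, hl, rfl⟩
    exact this
  have hatom : ∀ {a b : Atom Col δ K}, Literal.atom a = Literal.atom b → a = b := by
    intro a b h
    injection h
  ext F
  constructor
  · rintro ⟨ν, hν, hb, rfl⟩
    set ν' : Var → K := ν ∘ Function.invFunOn ρ r.vars with hν'
    have hinv : ∀ x ∈ r.vars, (ν' ∘ ρ) x = ν x := fun x hx => by
      simp only [hν', Function.comp_apply]
      rw [hρ.injOn.leftInvOn_invFunOn hx]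
    refine ⟨ν', ?_, ?_, ?_⟩
    · intro y hy
      obtain ⟨x, hx, rfl⟩ := hρ.surjOn hy
      have := hinv x hx
      rw [Function.comp_apply] at this
      exact this ▸ hν x hx
    · intro l hl
      have hl' : l ∈ (r'.body : Set (Literal Col δ (Term Var K))) := hl
      rw [← hbody] at hl'
      obtain ⟨l', hl', rfl⟩ := hl'
      rw [map_rename_map_subst,
        map_subst_congr fun x hx => hinv x (Rule.mem_vars_of_mem_body hl' hx)]
      exact hb l' hl'
    · have h1 := map_rename_map_subst (Literal.atom r.head) ρ ν'
      rw [map_subst_congr fun x hx => hinv x (Or.inr hx)] at h1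
      exact hatom (by simpa [Literal.map, hhead] using h1.symm)
  · rintro ⟨ν, hν, hb, rfl⟩
    refine ⟨ν ∘ ρ, fun x hx => hν _ (hρ.mapsTo hx), fun l hl => ?_, ?_⟩
    · rw [← map_rename_map_subst]
      exact hb _ (hmem l hl)
    · exact hatom (by simpa [Literal.map, hhead] using
        map_rename_map_subst (Literal.atom r.head) ρ ν)

theorem map_rename_edgeLit (ρ : Var → Var) (c : Col) (x y : Var) :
    (edgeLit c x y : Literal Col δ (Term Var K)).map (Term.rename ρ) = edgeLit c (ρ x) (ρ y) :=
  rfl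

theorem TreeLike.rename {ρ : Var → Var} (hρ : Function.Injective ρ) {x : Var}
    {φ : Set (Literal Col δ (Term Var K))} (h : TreeLike x φ) :
    TreeLike (ρ x) ((fun l => l.map (Term.rename ρ)) '' φ) := by
  induction h with
  | top x => simpa using TreeLike.top (ρ x)
  | unary x i =>
    rw [Set.image_singleton]
    exact TreeLike.unary (ρ x) i
  | and x φ₁ φ₂ _ _ hd ih₁ ih₂ =>
    rw [Set.image_union]
    refine TreeLike.and _ _ _ ih₁ ih₂ ?_
    rw [conjVars_image_rename, conjVars_image_rename, ← Set.image_inter hρ,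
      ← Set.image_singleton (f := ρ)]
    exact Set.image_mono hd
  | count x c n y φ hy _ hx hd ih =>
    have hins : ∀ i, insert (ρ (y i)) (conjVars ((fun l => l.map (Term.rename ρ)) '' φ i)) =
        ρ '' insert (y i) (conjVars (φ i)) := fun i => by
      rw [conjVars_image_rename, Set.image_insert_eq]
    have := TreeLike.count (ρ x) c n (ρ ∘ y)
      (fun i => (fun l : Literal Col δ (Term Var K) => l.map (Term.rename ρ)) '' φ i)
      (hρ.comp hy) ih (fun i => by
        rw [Function.comp_apply, hins, hρ.mem_set_image]
        exact hx i) (fun i j hij => by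
        rw [Function.comp_apply, Function.comp_apply, hins, hins, Set.disjoint_image_iff hρ]
        exact hd i j hij)
    convert this using 1
    rw [Set.image_union, Set.image_iUnion]
    congr 1
    · simp only [Set.image_insert_eq, map_rename_edgeLit, Function.comp_apply]
    · ext l
      constructor
      · rintro ⟨_, ⟨i, j, hij, rfl⟩, rfl⟩
        exact ⟨i, j, hij, rfl⟩
      · rintro ⟨i, j, hij, rfl⟩
        exact ⟨_, ⟨i, j, hij, rfl⟩, rfl⟩

theorem edgeLit_mem_image_rename {e : Equiv.Perm Var} {φ : Set (Literal Col δ (Term Var K))}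
    {c : Col} {x y : Var} :
    edgeLit c x y ∈ (fun l => l.map (Term.rename e)) '' φ ↔
      edgeLit c (e.symm x) (e.symm y) ∈ φ := by
  constructor
  · rintro ⟨l, hl, h⟩
    rcases l with (⟨i, t⟩ | ⟨c', t | a, s | b⟩) | ⟨t, s⟩ <;>
      simp [Literal.map, Atom.map, edgeLit, Term.rename] at h
    obtain ⟨rfl, rfl, rfl⟩ := h
    simpa [edgeLit] using hl
  · intro h
    exact ⟨_, h, by simp [map_rename_edgeLit]⟩

theorem HasDepth.rename (e : Equiv.Perm Var) {φ : Set (Literal Col δ (Term Var K))} {x : Var}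
    {n : ℕ} (h : HasDepth φ x n) :
    HasDepth ((fun l => l.map (Term.rename e)) '' φ) (e x) n := by
  refine ⟨?_, ?_⟩
  · obtain ⟨p, hp, hc⟩ := h.1
    exact ⟨e ∘ p, congrArg e hp, fun i hi => (hc i hi).imp fun c hc =>
      edgeLit_mem_image_rename.mpr (by simpa using hc)⟩
  · rintro m ⟨p, hp, hc⟩
    exact h.2 ⟨e.symm ∘ p, by simp [hp], fun i hi => (hc i hi).imp fun c hc =>
      edgeLit_mem_image_rename.mp hc⟩

theorem fanOut_rename (e : Equiv.Perm Var) (φ : Set (Literal Col δ (Term Var K))) (x : Var) :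
    fanOut ((fun l => l.map (Term.rename e)) '' φ) (e x) = fanOut φ x := by
  have : {y : Var | ∃ c : Col, edgeLit c (e x) y ∈ (fun l => l.map (Term.rename e)) '' φ} =
      e '' {y : Var | ∃ c : Col, edgeLit c x y ∈ φ} := by
    ext y
    simp only [edgeLit_mem_image_rename, Equiv.symm_apply_apply, e.image_eq_preimage_symm]
    rfl
  rw [fanOut, fanOut, this, Set.ncard_image_of_injective _ e.injective]

theorem Rule.IsTreeLike.exists_rename {d f : ℕ} {r : Rule Col δ Var K} (h : r.IsTreeLike d f)
    (e : Equiv.Perm Var) :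
    ∃ r' : Rule Col δ Var K, r'.IsTreeLike d f ∧ r.EqUpToRenaming r' ∧ r'.vars = e '' r.vars := by
  classical
  obtain ⟨x, i, hhead, htree, hvars⟩ := h
  set r' : Rule Col δ Var K :=
    ⟨r.body.image fun l => l.map (Term.rename e), r.head.map (Term.rename e)⟩ with hr'
  have hbody : (r'.body : Set (Literal Col δ (Term Var K))) =
      (fun l => l.map (Term.rename e)) '' (r.body : Set (Literal Col δ (Term Var K))) := by
    simp [hr']
  have hv : r'.vars = e '' r.vars := by
    have h2 := conjVars_image_rename e {Literal.atom r.head}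
    rw [Set.image_singleton] at h2
    rw [Rule.vars, Rule.vars, hbody, conjVars_image_rename, Set.image_union, ← h2]
    rfl
  refine ⟨r', ⟨e x, i, by simp [hr', hhead, Atom.map, Term.rename], ?_, ?_⟩,
    ⟨e, hv ▸ e.injective.injOn.bijOn_image, hbody.symm, rfl⟩, hv⟩
  · rw [hbody]
    exact htree.rename e.injective
  · rw [hbody, conjVars_image_rename]
    rintro _ ⟨y, hy, rfl⟩
    obtain ⟨n, h1, h2, h3⟩ := hvars y hy
    exact ⟨n, h1.rename e, h2, by rwa [fanOut_rename]⟩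

end Rename

/-! ### Finiteness of the set of tree-like rules up to renaming -/

section Finiteness

variable {Col : Type*} {δ : ℕ} {Var K : Type*}

/-- Every variable of a tree-like rule is reached from the root by at most `d` edge conjuncts, and
at most `f * d` of them leave each variable, which bounds the number of variables. -/
theorem Rule.IsTreeLike.exists_vars_subset {d f : ℕ} {r : Rule Col δ Var K}
    (h : r.IsTreeLike d f) :
    ∃ F : Finset Var, r.vars ⊆ F ∧ F.card ≤ ∑ n ∈ Finset.range (d + 1), (f * d) ^ n := by
  classical
  obtain ⟨x, i, hhead, htree, hvars⟩ := h
  set φ : Set (Literal Col δ (Term Var K)) := (r.body : Set (Literal Col δ (Term Var K))) with hφ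
  have hchild : ∀ y, ∃ S : Finset Var, (∀ c z, edgeLit c y z ∈ φ → z ∈ S) ∧ S.card ≤ f * d := by
    intro y
    by_cases hy : y ∈ conjVars φ
    · obtain ⟨n, -, -, hn⟩ := hvars y hy
      have hfin : {z : Var | ∃ c : Col, edgeLit c y z ∈ φ}.Finite := by
        refine Set.Finite.subset (s := ⋃ l ∈ φ, {z | ∃ c, edgeLit c y z = l})
          (r.body.finite_toSet.biUnion fun l _ => ?_) ?_
        · refine Set.Subsingleton.finite ?_
          rintro z ⟨c, rfl⟩ z' ⟨c', h⟩
          simp only [edgeLit, Literal.atom.injEq, Atom.edge.injEq, Term.var.injEq] at h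
          exact h.2.2.symm
        · rintro z ⟨c, hc⟩
          simp only [Set.mem_iUnion]
          exact ⟨_, hc, c, rfl⟩
      refine ⟨hfin.toFinset, fun c z hz => by simpa using ⟨c, hz⟩, ?_⟩
      rw [← Set.ncard_eq_toFinset_card _ hfin]
      exact hn.trans (Nat.mul_le_mul_left _ (Nat.sub_le _ _))
    · refine ⟨∅, fun c z hz => absurd (mem_conjVars_iff.mpr ⟨_, hz, ?_⟩) hy, by simp⟩
      rw [conjVars_edgeLit]
      exact Or.inl rfl
  choose S hS hSc using hchild
  have hlevel : ∀ n, ∃ F : Finset Var, (∀ y, EdgePath φ n x y → y ∈ F) ∧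
      F.card ≤ (f * d) ^ n := by
    intro n
    induction n with
    | zero =>
      refine ⟨{x}, ?_, by simp⟩
      rintro y ⟨p, h0, h1, -⟩
      simp [← h0, ← h1]
    | succ n ih =>
      obtain ⟨F, hF, hFc⟩ := ih
      refine ⟨F.biUnion S, ?_, ?_⟩
      · rintro y ⟨p, h0, rfl, hp⟩
        obtain ⟨c, hc⟩ := hp n (by omega)
        exact Finset.mem_biUnion.mpr
          ⟨p n, hF _ ⟨p, h0, rfl, fun i hi => hp i (by omega)⟩, hS _ c _ hc⟩
      · refine (Finset.card_biUnion_le_card_mul _ _ _ fun y _ => hSc y).trans ?_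
        rw [pow_succ]
        exact Nat.mul_le_mul_right _ hFc
  choose F hF hFc using hlevel
  refine ⟨(Finset.range (d + 1)).biUnion F, ?_,
    Finset.card_biUnion_le.trans (Finset.sum_le_sum fun n _ => hFc n)⟩
  rintro y (hy | hy)
  · obtain ⟨n, hn⟩ := htree.exists_edgePath y hy
    obtain ⟨m, hm, hmd, -⟩ := hvars y hy
    have hnm : n ≤ m := by
      obtain ⟨p, -, h1, h2⟩ := hn
      exact hm.2 ⟨p, h1, h2⟩
    simp only [Finset.coe_biUnion, Set.mem_iUnion]
    exact ⟨n, by simp; omega, hF n y hn⟩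
  · rw [hhead] at hy
    have hyx : y = x := by
      have h1 := conjVars_unaryLit (Col := Col) (K := K) i x
      rw [unaryLit] at h1
      rw [h1] at hy
      exact hy
    simp only [Finset.coe_biUnion, Set.mem_iUnion]
    exact ⟨0, by simp, hF 0 y ⟨fun _ => x, rfl, hyx.symm, by simp⟩⟩

theorem exists_perm_image_subset {F W : Finset Var} (h : F.card ≤ W.card) :
    ∃ e : Equiv.Perm Var, ∀ x ∈ F, e x ∈ W := by
  obtain ⟨g⟩ : Nonempty (F ↪ W) := Function.Embedding.nonempty_of_card_le (by simpa using h)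
  obtain ⟨e, he⟩ := Equiv.Perm.exists_extending_pair (fun x : F => (x : Var))
    (fun x : F => ((g x : W) : Var)) Subtype.val_injective (Subtype.val_injective.comp g.injective)
  exact ⟨e, fun x hx => by rw [he ⟨x, hx⟩]; exact (g ⟨x, hx⟩).2⟩

theorem TreeLike.literal_cases {x : Var} {φ : Set (Literal Col δ (Term Var K))}
    (h : TreeLike x φ) : ∀ l ∈ φ, (∃ i y, l = unaryLit i y) ∨ (∃ c y z, l = edgeLit c y z) ∨
      ∃ y z, l = neLit y z := by
  induction h with
  | top => simp
  | unary x i => exact fun l hl => Or.inl ⟨i, x, hl⟩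
  | and _ _ _ _ _ _ ih₁ ih₂ => exact fun l hl => hl.elim (ih₁ l) (ih₂ l)
  | count x c n y φ _ _ _ _ ih =>
    rintro l (hl | ⟨i, j, -, rfl⟩)
    · obtain ⟨i, rfl | hl⟩ := Set.mem_iUnion.mp hl
      · exact Or.inr (Or.inl ⟨_, _, _, rfl⟩)
      · exact ih i l hl
    · exact Or.inr (Or.inr ⟨_, _, rfl⟩)

theorem finite_setOf_isTreeLike_vars_subset [Finite Col] (d f : ℕ) (W : Finset Var) :
    {r : Rule Col δ Var K | r.IsTreeLike d f ∧ r.vars ⊆ W}.Finite := by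
  classical
  set A : Set (Literal Col δ (Term Var K)) :=
    Set.range (fun p : Fin δ × W => unaryLit p.1 (p.2 : Var)) ∪
      (Set.range (fun p : Col × W × W => edgeLit p.1 (p.2.1 : Var) p.2.2) ∪
        Set.range fun p : W × W => neLit (p.1 : Var) p.2) with hA
  have hAfin : A.Finite := (Set.finite_range _).union ((Set.finite_range _).union
    (Set.finite_range _))
  refine (Set.Finite.image (fun q : Finset (Literal Col δ (Term Var K)) × Atom Col δ (Term Var K) =>
    (⟨q.1, q.2⟩ : Rule Col δ Var K))
    (hAfin.toFinset.powerset.finite_toSet.prod (Set.finite_range fun p : Fin δ × W =>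
      Atom.unary (Col := Col) p.1 (Term.var (K := K) (p.2 : Var))))).subset ?_
  rintro ⟨b, a⟩ ⟨⟨x, i, hhead, htree, -⟩, hW⟩
  have hbW : ∀ l ∈ b, ∀ y ∈ conjVars ({l} : Set (Literal Col δ (Term Var K))), y ∈ W :=
    fun l hl y hy => hW (Rule.mem_vars_of_mem_body (r := ⟨b, a⟩) hl hy)
  refine ⟨(b, a), ⟨?_, ?_⟩, rfl⟩
  · rw [Finset.mem_coe, Finset.mem_powerset]
    intro l hl
    rw [Set.Finite.mem_toFinset]
    have hl' := hbW l hl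
    rcases htree.literal_cases l hl with ⟨j, y, rfl⟩ | ⟨c, y, z, rfl⟩ | ⟨y, z, rfl⟩
    · rw [conjVars_unaryLit] at hl'
      exact Or.inl ⟨(j, ⟨y, hl' y rfl⟩), rfl⟩
    · rw [conjVars_edgeLit] at hl'
      exact Or.inr (Or.inl ⟨(c, ⟨y, hl' y (by simp)⟩, ⟨z, hl' z (by simp)⟩), rfl⟩)
    · rw [conjVars_neLit] at hl'
      exact Or.inr (Or.inr ⟨(⟨y, hl' y (by simp)⟩, ⟨z, hl' z (by simp)⟩), rfl⟩)
  · have hx : x ∈ W := by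
      refine hW (Or.inr ?_)
      have h1 : x ∈ conjVars ({unaryLit i x} : Set (Literal Col δ (Term Var K))) := by
        rw [conjVars_unaryLit]
        rfl
      rw [hhead]
      exact h1
    exact ⟨(i, ⟨x, hx⟩), hhead.symm⟩

theorem MonotonicMaxSum.exists_isRuleProgram [Fintype Col] [Infinite Var] {N : GNN Col δ}
    (h : MonotonicMaxSum N) : ∃ P : Program Col δ Var K, h.IsRuleProgram P := by
  set f := Fintype.card Col * N.maxDim * h.capacity with hf
  obtain ⟨W, hWc⟩ := Infinite.exists_subset_card_eq Var
    (∑ n ∈ Finset.range (N.L + 1), (f * N.L) ^ n)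
  have hfin : {r : Rule Col δ Var K | (r.IsTreeLike N.L f ∧ r.vars ⊆ W) ∧ N.Captures r}.Finite :=
    (finite_setOf_isTreeLike_vars_subset N.L f W).subset fun r hr => hr.1
  refine ⟨hfin.toFinset, fun r hr => ?_, fun r hr hcap => ?_⟩
  · rw [Set.Finite.mem_toFinset] at hr
    exact ⟨hr.1.1, hr.2⟩
  · obtain ⟨F, hF, hFc⟩ := hr.exists_vars_subset
    obtain ⟨e, he⟩ := exists_perm_image_subset (hFc.trans_eq hWc.symm)
    obtain ⟨r', h1, h2, h3⟩ := hr.exists_rename e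
    refine ⟨r', ?_, h2⟩
    rw [Set.Finite.mem_toFinset]
    refine ⟨⟨h1, ?_⟩, fun D => h2.consequences_eq D ▸ hcap D⟩
    rw [h3]
    rintro _ ⟨x, hx, rfl⟩
    exact he x (hF hx)

end Finiteness

/-! ### The rule that describes a vertex of a dataset -/

section Unravelling

variable {Col : Type*} {δ : ℕ} {Var K : Type*}

theorem canEnc_label (D : Dataset Col δ K) (v : K) (i : Fin δ) :
    (canEnc D).label v i = 0 ∨ (canEnc D).label v i = 1 := by
  simp only [canEnc]
  split_ifs <;> simp

theorem mem_nbrs_canEnc {D : Dataset Col δ K} {c : Col} {v u : K} :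
    u ∈ (canEnc D).nbrs c v ↔ Atom.edge c v u ∈ D := by
  simp only [ColGraph.nbrs, Finset.mem_filter]
  exact ⟨fun h => h.2, fun h => ⟨((canEnc D).edge_mem c v u h).2, h⟩⟩

/-- For the sums of the `k ≤ C` largest values in each of `m` coordinates, at most `m * C` elements
of `s` are needed; they are returned as the first `n` members of a sequence. -/
theorem exists_enum_maxSum_eq {V : Type*} [Nonempty V] {m C : ℕ} {k : ℕ∞} (hk : k ≤ C)
    (s : Finset V) (f : V → Fin m → ℝ) :
    ∃ (n : ℕ) (e : ℕ → V), n ≤ m * C ∧ Set.InjOn e (Set.Iio n) ∧ (∀ i < n, e i ∈ s) ∧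
      ∀ j, ∃ I : Finset ℕ, (∀ i ∈ I, i < n) ∧ (I.card : ℕ∞) ≤ k ∧
        maxSum k (s.val.map fun u => f u j) = ∑ i ∈ I, f (e i) j := by
  classical
  choose T hTs hTc hT using fun j => exists_subset_maxSum_eq k s fun u => f u j
  set S := Finset.univ.biUnion T with hS
  set e : ℕ → V := fun i => if h : i < S.card then (S.equivFin.symm ⟨i, h⟩ : V) else
    Classical.arbitrary V with he
  have hei : ∀ i (h : i < S.card), e i = S.equivFin.symm ⟨i, h⟩ := fun i h => by simp [he, h]
  have hinj : Set.InjOn e (Set.Iio S.card) := by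
    intro i hi j hj hij
    rw [hei i hi, hei j hj] at hij
    exact Fin.mk.inj (S.equivFin.symm.injective (Subtype.ext hij))
  have hmem : ∀ i < S.card, e i ∈ S := fun i hi => by
    rw [hei i hi]
    exact Subtype.prop _
  refine ⟨S.card, e, ?_, hinj, fun i hi => ?_, fun j => ?_⟩
  · calc S.card ≤ (Finset.univ : Finset (Fin m)).card * C :=
        Finset.card_biUnion_le_card_mul _ _ _ fun j _ => by exact_mod_cast (hTc j).trans hk
      _ = m * C := by simp
  · obtain ⟨j, -, hj⟩ := Finset.mem_biUnion.mp (hmem i hi)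
    exact hTs j hj
  · set I := (Finset.range S.card).filter fun i => e i ∈ T j with hI
    have hIlt : ∀ i ∈ I, i < S.card := fun i hi =>
      Finset.mem_range.mp (Finset.mem_filter.mp hi).1
    have hIinj : Set.InjOn e I := hinj.mono fun i hi => hIlt i hi
    have himg : I.image e = T j := by
      ext u
      constructor
      · intro hu
        obtain ⟨i, hi, rfl⟩ := Finset.mem_image.mp hu
        exact (Finset.mem_filter.mp hi).2
      · intro hu
        have huS : u ∈ S := Finset.mem_biUnion.mpr ⟨j, Finset.mem_univ _, hu⟩
        have hlt := (S.equivFin ⟨u, huS⟩).2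
        have heq : e (S.equivFin ⟨u, huS⟩) = u := by
          rw [hei _ hlt]
          simp
        refine Finset.mem_image.mpr ⟨S.equivFin ⟨u, huS⟩, ?_, heq⟩
        exact Finset.mem_filter.mpr ⟨Finset.mem_range.mpr hlt, heq.symm ▸ hu⟩
    refine ⟨I, hIlt, ?_, ?_⟩
    · rw [← Finset.card_image_of_injOn hIinj, himg]
      exact hTc j
    · rw [hT j, ← himg, Finset.sum_image hIinj]

/-- The vertex for which a node of the tree stands, if the root stands for `t` and `e k c v i` is
the chosen neighbour number `i` of colour `c` of `v` in layer `k`. -/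
def vertexAt (e : ℕ → Col → K → ℕ → K) (t : K) : List (ℕ × Col × ℕ) → K
  | [] => t
  | (k, c, i) :: p => e k c (vertexAt e t p) i

/-- The formula that describes the vertex `t` of the dataset `D`, where the chosen neighbours of
colour `c` of `v` in layer `k` are `e k c v i` for `i < n k c v`. -/
def vertexForm (ι : List (ℕ × Col × ℕ) → Var) (D : Dataset Col δ K) (e : ℕ → Col → K → ℕ → K)
    (n : ℕ → Col → K → ℕ) (t : K) (ℓ : ℕ) (p : List (ℕ × Col × ℕ)) :
    Set (Literal Col δ (Term Var K)) :=
  treeForm ι (fun p => {i | Atom.unary i (vertexAt e t p) ∈ D})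
    (fun k c p => n k c (vertexAt e t p)) ℓ p

variable {ι : List (ℕ × Col × ℕ) → Var} {D : Dataset Col δ K} {e : ℕ → Col → K → ℕ → K}
  {n : ℕ → Col → K → ℕ} {t : K}

/-- The formula of a vertex is true in its own dataset. -/
theorem holds_vertexForm (hinj : ∀ k c v, Set.InjOn (e k c v) (Set.Iio (n k c v)))
    (hmem : ∀ k c v, ∀ i < n k c v, Atom.edge c v (e k c v i) ∈ D)
    {ν : Var → K} (hν : ∀ p, ν (ι p) = vertexAt e t p) :
    ∀ (ℓ : ℕ) (p : List (ℕ × Col × ℕ)), ∀ l ∈ vertexForm ι D e n t ℓ p,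
      (l.map (Term.subst ν)).Holds D := by
  intro ℓ
  induction ℓ with
  | zero =>
    intro p l hl
    simp only [vertexForm, treeForm, Set.mem_iUnion] at hl
    obtain ⟨i, hi, rfl⟩ := hl
    change Atom.unary i (ν (ι p)) ∈ D
    rw [hν]
    exact hi
  | succ ℓ ih =>
    rintro p l (hl | hl)
    · exact ih p l hl
    obtain ⟨c, hl | ⟨i, j, hij, rfl⟩⟩ := Set.mem_iUnion.mp hl
    · obtain ⟨i, rfl | hl⟩ := Set.mem_iUnion.mp hl
      · change Atom.edge c (ν (ι p)) (ν (ι _)) ∈ D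
        rw [hν, hν]
        exact hmem _ _ _ _ i.2
      · exact ih _ l hl
    · change ν (ι _) ≠ ν (ι _)
      rw [hν, hν]
      intro h
      exact hij.ne (Fin.ext (hinj _ _ _ i.2 j.2 h))

/-- Wherever the formula of a vertex is true, the value of the vertex computed with the reduced
numbers of summands is a lower bound of the value that the GNN computes. -/
theorem layerWith_le_of_holds [Fintype Col] {N : GNN Col δ} (h : MonotonicMaxSum N) {κ : ℕ → ℕ∞}
    (hκ : ∀ ℓ, κ ℓ ≤ h.k ℓ)
    (hsum : ∀ ℓ < N.L, ∀ c v j, ∃ I : Finset ℕ, (∀ i ∈ I, i < n ℓ c v) ∧ (I.card : ℕ∞) ≤ κ ℓ ∧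
      maxSum (κ ℓ) (((canEnc D).nbrs c v).val.map fun u => N.layerWith κ (canEnc D) ℓ u j) =
        ∑ i ∈ I, N.layerWith κ (canEnc D) ℓ (e ℓ c v i) j)
    (D' : Dataset Col δ K) (ν : Var → K) :
    ∀ ℓ ≤ N.L, ∀ p : List (ℕ × Col × ℕ),
      (∀ l ∈ vertexForm ι D e n t ℓ p, (l.map (Term.subst ν)).Holds D') →
      ∀ j, N.layerWith κ (canEnc D) ℓ (vertexAt e t p) j ≤
        N.layerWith h.k (canEnc D') ℓ (ν (ι p)) j := by
  intro ℓ
  induction ℓ with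
  | zero =>
    intro _ p hp j
    simp only [GNN.layerWith, canEnc]
    split_ifs with h1 h2 h2
    · exact le_rfl
    · refine absurd (hp (unaryLit (Fin.cast N.dim_zero j) (ι p)) ?_) h2
      simp only [vertexForm, treeForm, Set.mem_iUnion]
      exact ⟨_, h1, rfl⟩
    · exact zero_le_one
    · exact le_rfl
  | succ ℓ ih =>
    intro hℓ p hp j
    have hcount : ∀ c, ∀ l ∈ countForm ι (fun k c p => n k c (vertexAt e t p)) ℓ c p
        (fun i => vertexForm ι D e n t ℓ ((ℓ, c, i) :: p)), (l.map (Term.subst ν)).Holds D' :=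
      fun c l hl => hp l (Or.inr (Set.mem_iUnion.mpr ⟨c, hl⟩))
    refine h.monotone_act (h.preact_mono hℓ (ih (by omega) p fun l hl => hp l (Or.inl hl))
      (fun c j => ?_) j)
    obtain ⟨I, hI, hIc, hIs⟩ := hsum ℓ hℓ c (vertexAt e t p) j
    rw [hIs]
    have hne : ∀ i ∈ I, ∀ i' ∈ I, i < i' →
        ν (ι ((ℓ, c, i) :: p)) ≠ ν (ι ((ℓ, c, i') :: p)) := fun i hi i' hi' hlt =>
      hcount c _ (Or.inr ⟨⟨i, hI i hi⟩, ⟨i', hI i' hi'⟩, hlt, rfl⟩)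
    refine sum_le_maxSum_of_injOn (e := fun i => ν (ι ((ℓ, c, i) :: p)))
      (fun u _ => h.layerWith_nonneg _ (canEnc_label D') ℓ u j) ?_ (fun i hi => ?_)
      (fun i hi => ?_) (hIc.trans (hκ ℓ))
    · intro i hi i' hi' heq
      rcases lt_trichotomy i i' with hlt | hlt | hlt
      · exact absurd heq (hne i hi i' hi' hlt)
      · exact hlt
      · exact absurd heq.symm (hne i' hi' i hi hlt)
    · exact mem_nbrs_canEnc.mpr (hcount c _ (Or.inl (Set.mem_iUnion.mpr
        ⟨⟨i, hI i hi⟩, Set.mem_insert _ _⟩)))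
    · exact ih (by omega) ((ℓ, c, i) :: p) (fun l hl => hcount c l (Or.inl (Set.mem_iUnion.mpr
        ⟨⟨i, hI i hi⟩, Set.mem_insert_of_mem _ hl⟩))) j

theorem Dataset.right_mem_terms {D : Dataset Col δ K} {c : Col} {v u : K}
    (h : Atom.edge c v u ∈ D) : u ∈ Dataset.terms D :=
  ⟨_, h, Or.inr rfl⟩

theorem GNN.unary_mem_transform [Fintype Col] {N : GNN Col δ} (h : MonotonicMaxSum N)
    {D : Dataset Col δ K} {i : Fin δ} {t : K} :
    Atom.unary i t ∈ N.transform D ↔ t ∈ Dataset.terms D ∧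
      h.threshold ≤ N.layerWith h.k (canEnc D) N.L t (Fin.cast N.dim_last.symm i) := by
  rw [← h.layer_eq_layerWith _ _ le_rfl]
  have hcls : ∀ x, N.cls x = 1 ↔ h.threshold ≤ x := fun x => by
    refine ⟨fun hx => ?_, h.cls_eq_one x⟩
    by_contra hlt
    rw [h.cls_eq_zero x (not_le.mp hlt)] at hx
    exact zero_ne_one hx
  rw [← hcls]
  constructor
  · rintro (⟨c, t, s, -, hF⟩ | ⟨t', ht', i', hl, hF⟩)
    · exact absurd hF (by simp)
    · obtain ⟨rfl, rfl⟩ : i = i' ∧ t = t' := by simpa using hF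
      exact ⟨by simpa [GNN.apply, canEnc] using ht', hl⟩
  · rintro ⟨ht, hl⟩
    exact Or.inr ⟨t, by simpa [GNN.apply, canEnc] using ht, i, hl, rfl⟩

theorem GNN.edge_mem_transform [Fintype Col] {N : GNN Col δ} {D : Dataset Col δ K} {c : Col}
    {t s : K} : Atom.edge c t s ∈ N.transform D ↔ Atom.edge c t s ∈ D := by
  constructor
  · rintro (⟨c', t', s', he, hF⟩ | ⟨t', ht', i', hl, hF⟩)
    · rw [hF]
      exact he
    · exact absurd hF (by simp)
  · exact fun h => Or.inl ⟨c, t, s, h, rfl⟩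

/-- Each unary fact that the GNN derives is a consequence of a tree-like rule that the GNN
captures. -/
theorem MonotonicMaxSum.exists_rule_of_mem_transform [Fintype Col] [Infinite Var] {N : GNN Col δ}
    (h : MonotonicMaxSum N) {D : Dataset Col δ K} {i : Fin δ} {t : K}
    (hF : Atom.unary i t ∈ N.transform D) :
    ∃ r : Rule Col δ Var K, r.IsTreeLike N.L (Fintype.card Col * N.maxDim * h.capacity) ∧
      N.Captures r ∧ Atom.unary i t ∈ r.consequences D := by
  obtain ⟨ht, hthr⟩ := (GNN.unary_mem_transform h).mp hF
  replace hthr := h.threshold_le_layerWith (canEnc_label D) hthr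
  set κ : ℕ → ℕ∞ := fun ℓ => min h.capacity (h.k ℓ) with hκ
  have hchild : ∀ ℓ c v, ∃ (n : ℕ) (e : ℕ → K), n ≤ N.maxDim * h.capacity ∧
      Set.InjOn e (Set.Iio n) ∧ (∀ i < n, Atom.edge c v (e i) ∈ D) ∧
      (ℓ < N.L → ∀ j, ∃ I : Finset ℕ, (∀ i ∈ I, i < n) ∧ (I.card : ℕ∞) ≤ κ ℓ ∧
        maxSum (κ ℓ) (((canEnc D).nbrs c v).val.map fun u => N.layerWith κ (canEnc D) ℓ u j) =
          ∑ i ∈ I, N.layerWith κ (canEnc D) ℓ (e i) j) := by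
    intro ℓ c v
    by_cases hℓ : ℓ < N.L
    · have : Nonempty K := ⟨t⟩
      obtain ⟨n, e, h1, h2, h3, h4⟩ := exists_enum_maxSum_eq (k := κ ℓ) (min_le_left _ _)
        ((canEnc D).nbrs c v) (N.layerWith κ (canEnc D) ℓ)
      exact ⟨n, e, h1.trans (Nat.mul_le_mul_right _ (Finset.le_sup (f := N.dim)
        (Finset.mem_range.mpr (by omega)))), h2, fun i hi => mem_nbrs_canEnc.mp (h3 i hi),
        fun _ => h4⟩
    · exact ⟨0, fun _ => t, Nat.zero_le _, by simp, by simp, fun h => absurd h hℓ⟩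
  choose n e hn hinj hmem hsum using hchild
  obtain ⟨g, hg⟩ := exists_injective_nat (List (ℕ × Col × ℕ))
  obtain ⟨ι, hι⟩ : ∃ ι : List (ℕ × Col × ℕ) → Var, Function.Injective ι :=
    ⟨Infinite.natEmbedding Var ∘ g, (Infinite.natEmbedding Var).injective.comp hg⟩
  have hfin : (vertexForm ι D e n t N.L []).Finite := finite_treeForm _ _
  set r : Rule Col δ Var K := ⟨hfin.toFinset, Atom.unary i (Term.var (ι []))⟩ with hr
  have hbody : (r.body : Set (Literal Col δ (Term Var K))) = vertexForm ι D e n t N.L [] := by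
    simp [hr]
  have hmemb : ∀ l, l ∈ r.body ↔ l ∈ vertexForm ι D e n t N.L [] := fun l => by
    rw [← Finset.mem_coe, hbody]
  refine ⟨r, ⟨ι [], i, rfl, ?_, ?_⟩, ?_, ?_⟩
  · rw [hbody]
    exact treeLike_treeForm hι _ _
  · rw [hbody]
    intro y hy
    obtain ⟨q, rfl, hq, hd⟩ := hasDepth_treeForm hι hy
    refine ⟨q.length, hd, hq, ?_⟩
    rw [mul_assoc (Fintype.card Col)]
    exact fanOut_treeForm_le hι (fun k c p => hn _ _ _) _ _
  · rintro D' F ⟨ν, hν, hb, rfl⟩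
    refine (GNN.unary_mem_transform h).mpr ⟨hν (ι []) (Or.inr ?_), hthr.trans ?_⟩
    · have := conjVars_unaryLit (Col := Col) (K := K) i (ι [])
      rw [unaryLit] at this
      rw [hr, this]
      rfl
    · exact layerWith_le_of_holds h (fun _ => min_le_right _ _)
        (fun ℓ hℓ c v => hsum ℓ c v hℓ) D' ν N.L le_rfl [] (fun l hl => hb l ((hmemb l).mpr hl)) _
  · set ν : Var → K := vertexAt e t ∘ Function.invFun ι with hν
    have hνι : ∀ p, ν (ι p) = vertexAt e t p := fun p => by
      rw [hν, Function.comp_apply, Function.leftInverse_invFun hι]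
    have hholds := holds_vertexForm (D := D) hinj hmem hνι N.L []
    refine ⟨ν, ?_, fun l hl => hholds l ((hmemb l).mp hl), ?_⟩
    · have hroot : ν (ι []) ∈ Dataset.terms D := by
        rw [hνι]
        exact ht
      rintro x (hx | hx)
      · rw [hbody] at hx
        -- a variable other than the root is the end of an edge conjunct
        obtain ⟨m, P, h0, rfl, hP⟩ := (treeLike_treeForm hι _ _).exists_edgePath x hx
        rcases m with _ | m
        · rw [h0]
          exact hroot
        · obtain ⟨c, hc⟩ := hP m (by omega)
          exact Dataset.right_mem_terms (hholds _ hc)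
      · have h1 := conjVars_unaryLit (Col := Col) (K := K) i (ι [])
        rw [unaryLit] at h1
        rw [hr, h1] at hx
        rw [Set.mem_singleton_iff.mp hx]
        exact hroot
    · simp only [hr, Atom.map, Term.subst, hνι]
      rfl

end Unravelling
end MaxSumGNN

end

theorem mainTheorem1 {Col : Type*} [Fintype Col] {δ : ℕ} {Var K : Type*} [Infinite Var]
    [Infinite K] (N : MaxSumGNN.GNN Col δ) (hN : MaxSumGNN.MonotonicMaxSum N) :
    (∃ P : MaxSumGNN.Program Col δ Var K, hN.IsRuleProgram P) ∧
    ∀ P : MaxSumGNN.Program Col δ Var K, hN.IsRuleProgram P →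
      ∀ D : MaxSumGNN.Dataset Col δ K,
        N.transform D = MaxSumGNN.Program.consequences P D ∪
          {F | F ∈ D ∧ ∃ c t s, F = MaxSumGNN.Atom.edge c t s} := by
  refine ⟨hN.exists_isRuleProgram, fun P hP D => Set.Subset.antisymm ?_ ?_⟩
  · rintro (⟨i, t⟩ | ⟨c, t, s⟩) hF
    · left
      obtain ⟨r, hr, hcap, hmem⟩ := hN.exists_rule_of_mem_transform (Var := Var) hF
      obtain ⟨r', hr', hrr'⟩ := hP.2 r hr hcap
      rw [hrr'.consequences_eq] at hmem
      exact Set.mem_biUnion hr' hmem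
    · exact Or.inr ⟨MaxSumGNN.GNN.edge_mem_transform.mp hF, c, t, s, rfl⟩
  · rintro F (hF | ⟨hF, c, t, s, rfl⟩)
    · obtain ⟨r, hr, hF⟩ := Set.mem_iUnion₂.mp hF
      exact (hP.1 r hr).2 D hF
    · exact MaxSumGNN.GNN.edge_mem_transform.mpr hF
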